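/- Let $\tau>0$, let $\mathbf k\in\mathbb R^3$ (in particular $\mathbf k\in\mathbb Z^3$) with $0<k:=|\mathbf k|<k_{\rm crit,min}=\sqrt{\pi/2}\,/\tau$, and let $\mathbf Q_{\mathbf k}\in SO(3)$ satisfy $\mathbf Q_{\mathbf k}(k,0,0)^T=\mathbf k$; put $\tilde{\mathbf Q}_{\mathbf k}=\mathrm{diag}(1,\mathbf Q_{\mathbf k},1)$. Let $\mathcal H_{\mathbf v}=L^2(\mathbb R^3,(2\pi)^{-3/2}e^{-|\mathbf v|^2/2}d\mathbf v;\mathbb C)$ with inner product $\langle f,g\rangle=(2\pi)^{-3/2}\int f g^*e^{-|\mathbf v|^2/2}d\mathbf v$ and orthonormal vectors $(e_0,\dots,e_4)=(1,v_1,v_2,v_3,(|\mathbf v|^2-3)/\sqrt6)$. For $f\in\mathcal H_{\mathbf v}$ let $\hat{\mathbf h}(f)=(\langle f,e_j\rangle)_{0\le j\le4}=(\rho,\mathbf u,\sqrt{3/2}\,T)$ be its macroscopic variables and $\mathbb P_5f=\sum_j\langle f,e_j\rangle e_j$. Consider the linearized BGK operator $\mathcal L_{\mathbf k}=-\mathrm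 i\,\mathbf v\cdot\mathbf k-\frac1\tau(1-\mathbb P_5)$ with domain $\{f:(\mathbf v\cdot\mathbf k)f\in\mathcal H_{\mathbf v}\}$. Let $\lambda_{\rm diff}\in\mathbb R$, $\lambda_{\rm ac},\lambda_{\rm ac}^*\in\mathbb C\setminus\mathbb R$ and $\lambda_{\rm shear}$ be the hydrodynamic modes: eigenvalues of $\mathcal L_{\mathbf k}$ in the strip $-1/\tau<\Re\lambda<0$, the first three (the simple ones, $\boldsymbol\lambda_{\rm simple}=(\lambda_{\rm diff},\lambda_{\rm ac},\lambda_{\rm ac}^*)$) with one-dimensional eigenspace and $\lambda_{\rm shear}$ with two-dimensional eigenspace. Put $\boldsymbol\Lambda=\mathrm{diag}(\lambda_{\rm diff},\lambda_{\rm ac},\lambda_{\rm ac}^*,\lambda_{\rm shear},\lambda_{\rm shear})$, and let the hydrodynamic manifold $\mathcal M_{\rm hydro,\mathbf k}$ be the span of the corresponding eigenspaces. Then there is exactly one choice of eigenvectors $\hat f_{\lambda_{\rm diff}},\hat f_{\lambda_{\rm ac}},\hat f_{\lambda_{\rm ac}^*},\hat f_{{\rm shear},1},\hat f_{{\rm shear},2}$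 of $\mathcal L_{\mathbf k}$ for these eigenvalues with $\langle\hat f_\lambda,1\rangle=1$ for the simple eigenvalues and $\hat{\mathbf h}(\hat f_{{\rm shear},1})=\tilde{\mathbf Q}_{\mathbf k}(0,0,1,0,0)^T$, $\hat{\mathbf h}(\hat f_{{\rm shear},2})=\tilde{\mathbf Q}_{\mathbf k}(0,0,0,1,0)^T$. Let $\mathbf H\in\mathbb C^{5\times5}$ be the spectral basis matrix whose columns are the macroscopic variables of these five eigenvectors. With $Z(\zeta)=\frac1{\sqrt{2\pi}}\int_{\mathbb R}\frac{e^{-v^2/2}}{v-\zeta}dv$ let $$\theta(\lambda)=\left.\frac{\mathrm i\sqrt6\left(k^2\tau^2+\mathrm i\zeta k\tau+Z(\zeta)(\zeta+\mathrm i(\zeta^2+1)k\tau)+1\right)}{k\tau\left(\zeta+(\zeta^2-1)Z(\zeta)\right)}\right|_{\zeta=\mathrm i\frac{\tau\lambda+1}{\tau k}}$$ be the spectral temperature. Suppose $\mathbf H$ is invertible. With sums and products over the three cyclic permutations $(\lambda_1,\lambda_2,\lambda_3)$ of $\boldsymbol\lambda_{\rm simple}$, set $$C_1=\frac{1}{k^2\det\mathbf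 H}\sum\lambda_1\lambda_3(\lambda_1-\lambda_3)\theta(\lambda_2),\quad C_2=\frac{\mathrm i}{k\det\mathbf H}\sum(\lambda_1^2-\lambda_3^2)\theta(\lambda_2),\quad C_3=-\frac1{k^2\det\mathbf H}\prod(\lambda_1-\lambda_2),$$ $$C_4=\frac{\mathrm i}{k\det\mathbf H}\sum\lambda_2(\lambda_1-\lambda_3)\theta(\lambda_1)\theta(\lambda_3),\quad C_5=\frac1{\det\mathbf H}\sum(\lambda_3-\lambda_1)\theta(\lambda_1)\theta(\lambda_3),\quad C_6=-\frac{\mathrm i}{k\det\mathbf H}\sum\lambda_1\theta(\lambda_1)(\lambda_2-\lambda_3).$$ Then: 1. for every solution $\hat f:[0,\infty)\to\mathcal M_{\rm hydro,\mathbf k}$ of $\partial_t\hat f=\mathcal L_{\mathbf k}\hat f$, the macroscopic variables $\hat{\mathbf h}_{\rm hydro}(t)=\hat{\mathbf h}(\hat f(t))$ satisfy $\partial_t\hat{\mathbf h}_{\rm hydro}=\mathbf H\boldsymbol\Lambda\mathbf H^{-1}\hat{\mathbf h}_{\rm hydro}$; 2. $$\mathbf H\boldsymbol\Lambda\mathbf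 H^{-1}=\tilde{\mathbf Q}_{\mathbf k}\begin{pmatrix}0&-\mathrm ik&0&0&0\\C_1&C_2&0&0&C_3\\0&0&\lambda_{\rm shear}&0&0\\0&0&0&\lambda_{\rm shear}&0\\C_4&C_5&0&0&C_6\end{pmatrix}\tilde{\mathbf Q}_{\mathbf k}^T;$$ 3. $C_1,C_3,C_5$ are purely imaginary and $C_2,C_4,C_6$ are real: there are $c_1,\dots,c_6\in\mathbb R$ with $C_1=\mathrm ic_1$, $C_2=c_2$, $C_3=\mathrm ic_3$, $C_4=c_4$, $C_5=\mathrm ic_5$, $C_6=c_6$, and the equation in 1. holds with the matrix in 2. written in terms of the $c_j$. -/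

import Mathlib

open MeasureTheory

noncomputable section

namespace BGK

/-- Velocity space / wave vector space `ℝ³` with the Euclidean norm. -/
abbrev R3 : Type := EuclideanSpace ℝ (Fin 3)

/-- The Maxwellian weight `(2π)^{-3/2} e^{-|v|²/2} dv`. -/
def maxwellian : Measure R3 :=
  volume.withDensity fun v =>
    ENNReal.ofReal ((2 * Real.pi) ^ (-(3 : ℝ) / 2) * Real.exp (-‖v‖ ^ 2 / 2))

/-- The Hilbert space `L²(ℝ³, (2π)^{-3/2} e^{-|v|²/2} dv; ℂ)`. -/
abbrev Hv : Type := Lp ℂ 2 maxwellian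

/-- The five collision invariants `1, v₁, v₂, v₃, (|v|² - 3)/√6`. -/
def eFun : Fin 5 → R3 → ℂ :=
  ![fun _ => 1,
    fun v => ((v 0 : ℝ) : ℂ),
    fun v => ((v 1 : ℝ) : ℂ),
    fun v => ((v 2 : ℝ) : ℂ),
    fun v => (((‖v‖ ^ 2 - 3) / Real.sqrt 6 : ℝ) : ℂ)]

theorem continuous_eFun (j : Fin 5) : Continuous (eFun j) := by
  fin_cases j <;> simp only [eFun] <;> simp <;> fun_prop

theorem norm_eFun_le (j : Fin 5) (v : R3) : ‖eFun j v‖ ≤ ‖v‖ ^ 2 + 3 := by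
  have hc : ∀ i : Fin 3, |v i| ≤ ‖v‖ ^ 2 + 3 := by
    intro i
    have h := PiLp.norm_apply_le v i
    rw [Real.norm_eq_abs] at h
    nlinarith [sq_nonneg (‖v‖ - 1)]
  have h6 : (1 : ℝ) ≤ Real.sqrt 6 := by
    rw [Real.one_le_sqrt]; norm_num
  fin_cases j
  · simp [eFun]; nlinarith [sq_nonneg ‖v‖]
  · simpa [eFun] using hc 0
  · simpa [eFun] using hc 1
  · simpa [eFun] using hc 2
  · have h0 : ‖eFun 4 v‖ = |‖v‖ ^ 2 - 3| / Real.sqrt 6 := by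
      have : eFun 4 v = (((‖v‖ ^ 2 - 3) / Real.sqrt 6 : ℝ) : ℂ) := rfl
      rw [this, Complex.norm_real, Real.norm_eq_abs, abs_div,
        abs_of_nonneg (Real.sqrt_nonneg 6)]
    change ‖eFun 4 v‖ ≤ _
    rw [h0]
    refine (div_le_self (abs_nonneg _) h6).trans ?_
    rw [abs_le]
    constructor <;> nlinarith [sq_nonneg ‖v‖]

theorem memLp_eFun (j : Fin 5) : MemLp (eFun j) 2 maxwellian := by
  rw [memLp_two_iff_integrable_sq_norm (continuous_eFun j).aestronglyMeasurable]
  have hdens : Measurable fun v : R3 =>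
      ENNReal.ofReal ((2 * Real.pi) ^ (-(3 : ℝ) / 2) * Real.exp (-‖v‖ ^ 2 / 2)) := by
    fun_prop
  rw [maxwellian, integrable_withDensity_iff hdens
    (Filter.Eventually.of_forall fun _ => ENNReal.ofReal_lt_top)]
  have hpos : ∀ v : R3,
      0 ≤ (2 * Real.pi) ^ (-(3 : ℝ) / 2) * Real.exp (-‖v‖ ^ 2 / 2) := by
    intro v; positivity
  simp_rw [fun v => ENNReal.toReal_ofReal (hpos v)]
  have hg : Integrable (fun v : R3 => Real.exp (-(1 / 4 : ℝ) * ‖v‖ ^ 2)) := by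
    have h := (GaussianFourier.integrable_cexp_neg_mul_sq_norm_add (V := R3)
      (b := ((1 / 4 : ℝ) : ℂ)) (by simp) 0 0).norm
    refine h.congr (Filter.Eventually.of_forall fun v => ?_)
    simp only [Complex.norm_exp]
    congr 1
    simp [← Complex.ofReal_pow]
  refine (hg.const_mul ((2 * Real.pi) ^ (-(3 : ℝ) / 2) * 256)).mono' ?_ ?_
  · have := continuous_eFun j
    exact Continuous.aestronglyMeasurable (by fun_prop)
  · refine Filter.Eventually.of_forall fun v => ?_
    have h1 := norm_eFun_le j v
    have h2 : (‖v‖ ^ 2 + 3) ^ 2 ≤ 256 * Real.exp (‖v‖ ^ 2 / 4) := by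
      have h3 : ‖v‖ ^ 2 / 8 + 1 ≤ Real.exp (‖v‖ ^ 2 / 8) := Real.add_one_le_exp _
      have h4 : Real.exp (‖v‖ ^ 2 / 4) = Real.exp (‖v‖ ^ 2 / 8) ^ 2 := by
        rw [← Real.exp_nat_mul]; congr 1; push_cast; ring
      rw [h4]
      nlinarith [sq_nonneg ‖v‖, Real.exp_pos (‖v‖ ^ 2 / 8)]
    have h5 : Real.exp (-‖v‖ ^ 2 / 2) * Real.exp (‖v‖ ^ 2 / 4)
        = Real.exp (-(1 / 4 : ℝ) * ‖v‖ ^ 2) := by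
      rw [← Real.exp_add]; congr 1; ring
    have h6 : ‖eFun j v‖ ^ 2 ≤ 256 * Real.exp (‖v‖ ^ 2 / 4) :=
      (pow_le_pow_left₀ (norm_nonneg _) h1 2).trans h2
    rw [Real.norm_of_nonneg (mul_nonneg (sq_nonneg _) (hpos v)), ← h5]
    calc ‖eFun j v‖ ^ 2 * ((2 * Real.pi) ^ (-(3 : ℝ) / 2) * Real.exp (-‖v‖ ^ 2 / 2))
        ≤ (256 * Real.exp (‖v‖ ^ 2 / 4)) *
            ((2 * Real.pi) ^ (-(3 : ℝ) / 2) * Real.exp (-‖v‖ ^ 2 / 2)) :=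
          mul_le_mul_of_nonneg_right h6 (hpos v)
      _ = _ := by ring

/-- The basis functions as elements of the Hilbert space. -/
def e (j : Fin 5) : Hv := (memLp_eFun j).toLp (eFun j)

/-- The macroscopic variables `(ρ, u₁, u₂, u₃, √(3/2) T)`, i.e. `⟨f, e_j⟩ = ∫ f ē_j dμ`
(Mathlib's inner product is conjugate-linear in the first slot). -/
def moments (f : Hv) : Fin 5 → ℂ := fun j => inner ℂ (e j) f

/-- The projection `ℙ₅ f = ∑ⱼ ⟨f, e_j⟩ e_j`. -/
def P5 (f : Hv) : Hv := ∑ j, moments f j • e j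

theorem P5_add (f g : Hv) : P5 (f + g) = P5 f + P5 g := by
  simp [P5, moments, inner_add_right, add_smul, Finset.sum_add_distrib]

theorem P5_smul (c : ℂ) (f : Hv) : P5 (c • f) = c • P5 f := by
  simp only [P5, moments, inner_smul_right, mul_smul, Finset.smul_sum]

/-- The function `v ↦ (v · k) f(v)`. -/
def transport (k : R3) (f : Hv) : R3 → ℂ := fun v => ((inner ℝ v k : ℝ) : ℂ) * f v

theorem transport_add (k : R3) (f g : Hv) :
    transport k (f + g) =ᵐ[maxwellian] transport k f + transport k g := by
  filter_upwards [Lp.coeFn_add f g] with v hv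
  simp only [transport, hv, Pi.add_apply, mul_add]

theorem transport_smul (k : R3) (c : ℂ) (f : Hv) :
    transport k (c • f) =ᵐ[maxwellian] c • transport k f := by
  filter_upwards [Lp.coeFn_smul c f] with v hv
  simp only [transport, hv, Pi.smul_apply, smul_eq_mul, mul_left_comm]

/-- The linearized BGK operator at wave vector `k` with relaxation time `τ`,
`L_k f = -i (v · k) f - τ⁻¹ (f - ℙ₅ f)`, an unbounded operator on the Hilbert space with its
maximal domain `{f | (v · k) f ∈ L²}`. -/
def bgkOp (τ : ℝ) (k : R3) : Hv →ₗ.[ℂ] Hv where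
  domain :=
    { carrier := {f | MemLp (transport k f) 2 maxwellian}
      add_mem' := fun {f g} hf hg => (memLp_congr_ae (transport_add k f g)).2 (hf.add hg)
      zero_mem' := by
        have h : transport k (0 : Hv) =ᵐ[maxwellian] (0 : R3 → ℂ) := by
          filter_upwards [Lp.coeFn_zero ℂ 2 maxwellian] with v hv
          simp only [transport, hv, Pi.zero_apply, mul_zero]
        exact (memLp_congr_ae h).2 MemLp.zero
      smul_mem' := fun c f hf =>
        (memLp_congr_ae (transport_smul k c f)).2 (hf.const_smul c) }
  toFun :=
    { toFun := fun f => (-Complex.I) • (MemLp.toLp (transport k f.1) f.2 : Hv)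
        - ((1 / τ : ℝ) : ℂ) • (f.1 - P5 f.1)
      map_add' := fun f g => by
        have h : (MemLp.toLp (transport k (f + g).1) (f + g).2 : Hv)
            = MemLp.toLp (transport k f.1) f.2 + MemLp.toLp (transport k g.1) g.2 := by
          rw [← MemLp.toLp_add]
          exact MemLp.toLp_congr _ _ (transport_add k f.1 g.1)
        rw [h, Submodule.coe_add, P5_add]
        module
      map_smul' := fun c f => by
        have h : (MemLp.toLp (transport k (c • f).1) (c • f).2 : Hv)
            = c • MemLp.toLp (transport k f.1) f.2 := by
          rw [← MemLp.toLp_const_smul]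
          exact MemLp.toLp_congr _ _ (transport_smul k c f.1)
        rw [h, Submodule.coe_smul, P5_smul, RingHom.id_apply]
        module }

/-- The eigenspace `{f ∈ D(L_k) | L_k f = lam f}`. -/
def eigenspace (τ : ℝ) (k : R3) (lam : ℂ) : Submodule ℂ Hv where
  carrier := {f | (f, lam • f) ∈ (bgkOp τ k).graph}
  add_mem' := fun {f g} hf hg => by
    simpa [smul_add] using (bgkOp τ k).graph.add_mem hf hg
  zero_mem' := by
    change ((0 : Hv), lam • (0 : Hv)) ∈ (bgkOp τ k).graph
    rw [smul_zero]
    exact (bgkOp τ k).graph.zero_mem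
  smul_mem' := fun c f hf => by
    simpa [smul_comm lam c f] using (bgkOp τ k).graph.smul_mem c hf

/-- The open strip `-a < Re z < 0`. -/
def strip (a : ℝ) : Set ℂ := {z | -a < z.re ∧ z.re < 0}

/-- The vector `(λ_diff, λ_ac, λ_ac*)` of simple eigenvalues. -/
def simpleModes (ldiff lac : ℂ) : Fin 3 → ℂ := ![ldiff, lac, star lac]

/-- The eigenvalues counted with multiplicity,
`(λ_diff, λ_ac, λ_ac*, λ_shear, λ_shear)`. -/
def allModes (ldiff lac lsh : ℂ) : Fin 5 → ℂ := ![ldiff, lac, star lac, lsh, lsh]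

/-- `λ_diff`, the pair `λ_ac, λ_ac*` and `λ_shear` are hydrodynamic modes of `L_k`: eigenvalues
between the essential spectrum and the imaginary axis, `λ_diff` real and `λ_ac` non-real,
`λ_diff, λ_ac, λ_ac*` with one-dimensional eigenspace, `λ_shear` with two-dimensional
eigenspace. -/
structure IsHydroModes (τ : ℝ) (k : R3) (ldiff lac lsh : ℂ) : Prop where
  mem_strip : ∀ j, allModes ldiff lac lsh j ∈ strip (1 / τ)
  diff_real : ldiff.im = 0
  ac_nonreal : lac.im ≠ 0
  simple : ∀ j, Module.finrank ℂ (eigenspace τ k (simpleModes ldiff lac j)) = 1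
  shear : Module.finrank ℂ (eigenspace τ k lsh) = 2

/-- The hydrodynamic manifold: the span of all eigenvectors to the modes. -/
def hydroManifold (τ : ℝ) (k : R3) (ldiff lac lsh : ℂ) : Submodule ℂ Hv :=
  ⨆ j, eigenspace τ k (allModes ldiff lac lsh j)

/-- `f` solves `∂_t f = L_k f` for `t ≥ 0` and stays on the hydrodynamic manifold. -/
def IsHydroSolution (τ : ℝ) (k : R3) (ldiff lac lsh : ℂ) (f : ℝ → Hv) : Prop :=
  ∀ t, 0 ≤ t → f t ∈ hydroManifold τ k ldiff lac lsh ∧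
    ∃ f' : Hv, (f t, f') ∈ (bgkOp τ k).graph ∧ HasDerivWithinAt f f' (Set.Ici 0) t

/-- `Q` is a rotation of `ℝ³` with `Q (|k|, 0, 0)ᵀ = k`. -/
def IsAligning (k : R3) (Q : Matrix (Fin 3) (Fin 3) ℝ) : Prop :=
  Q ∈ Matrix.specialOrthogonalGroup (Fin 3) ℝ ∧ Q.mulVec ![‖k‖, 0, 0] = k.ofLp

/-- The block-diagonal matrix `diag(1, Q, 1)`. -/
def Qtilde (Q : Matrix (Fin 3) (Fin 3) ℝ) : Matrix (Fin 5) (Fin 5) ℂ :=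
  (!![1, 0, 0, 0, 0;
      0, Q 0 0, Q 0 1, Q 0 2, 0;
      0, Q 1 0, Q 1 1, Q 1 2, 0;
      0, Q 2 0, Q 2 1, Q 2 2, 0;
      0, 0, 0, 0, 1] : Matrix (Fin 5) (Fin 5) ℝ).map Complex.ofReal

/-- `F = (f_diff, f_ac, f_ac*, f_shear1, f_shear2)` consists of eigenvectors of `L_k`, normalized
by `⟨f, 1⟩ = 1` for the simple eigenvalues and, for the two-dimensional shear eigenspace, by
prescribing the macroscopic variables `Q̃ (0,0,1,0,0)ᵀ` and `Q̃ (0,0,0,1,0)ᵀ`. -/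
structure IsSpectralBasis (τ : ℝ) (k : R3) (Q : Matrix (Fin 3) (Fin 3) ℝ)
    (ldiff lac lsh : ℂ) (F : Fin 5 → Hv) : Prop where
  eigen : ∀ j, F j ∈ eigenspace τ k (allModes ldiff lac lsh j)
  norm_diff : moments (F 0) 0 = 1
  norm_ac : moments (F 1) 0 = 1
  norm_ac_star : moments (F 2) 0 = 1
  shear_one : moments (F 3) = (Qtilde Q).mulVec ![0, 0, 1, 0, 0]
  shear_two : moments (F 4) = (Qtilde Q).mulVec ![0, 0, 0, 1, 0]

/-- The spectral basis matrix `H`, whose columns are the macroscopic variables of the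
eigenvectors. -/
def spectralMatrix (F : Fin 5 → Hv) : Matrix (Fin 5) (Fin 5) ℂ :=
  Matrix.of fun i j => moments (F j) i

/-- The plasma dispersion function `Z(ζ) = (2π)^{-1/2} ∫ e^{-v²/2} / (v - ζ) dv`
(used for `Im ζ ≠ 0`). -/
def plasmaZ (ζ : ℂ) : ℂ :=
  ((1 / Real.sqrt (2 * Real.pi) : ℝ) : ℂ) *
    ∫ v : ℝ, ((Real.exp (-v ^ 2 / 2) : ℝ) : ℂ) / ((v : ℂ) - ζ)

/-- The spectral temperature `θ(lam)` at wave number `κ = |k|`, with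
`ζ = i (τ lam + 1) / (τ κ)`. -/
def spectralTemp (τ κ : ℝ) (lam : ℂ) : ℂ :=
  let ζ : ℂ := Complex.I * (τ * lam + 1) / (τ * κ)
  Complex.I * (Real.sqrt 6 : ℝ) *
      ((κ : ℂ) ^ 2 * (τ : ℂ) ^ 2 + Complex.I * ζ * κ * τ
        + plasmaZ ζ * (ζ + Complex.I * (ζ ^ 2 + 1) * κ * τ) + 1) /
    (κ * τ * (ζ + (ζ ^ 2 - 1) * plasmaZ ζ))

/-- `∑ g(x₁, x₂, x₃)` over the cyclic permutations of `x`. -/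
def cyclicSum (x : Fin 3 → ℂ) (g : ℂ → ℂ → ℂ → ℂ) : ℂ :=
  ∑ i : Fin 3, g (x i) (x (i + 1)) (x (i + 2))

/-- `∏ g(x₁, x₂, x₃)` over the cyclic permutations of `x`. -/
def cyclicProd (x : Fin 3 → ℂ) (g : ℂ → ℂ → ℂ → ℂ) : ℂ :=
  ∏ i : Fin 3, g (x i) (x (i + 1)) (x (i + 2))

/-- The transport coefficients `C₁, …, C₆` (indexed by `0, …, 5`) at wave number `κ`, for the
vector `x` of simple eigenvalues, the function `θ` and the determinant `D = det H`. -/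
def transportC (κ : ℝ) (x : Fin 3 → ℂ) (θ : ℂ → ℂ) (D : ℂ) : Fin 6 → ℂ :=
  ![1 / ((κ : ℂ) ^ 2 * D) * cyclicSum x (fun a b c => a * c * (a - c) * θ b),
    Complex.I / (κ * D) * cyclicSum x (fun a b c => (a ^ 2 - c ^ 2) * θ b),
    -(1 / ((κ : ℂ) ^ 2 * D)) * cyclicProd x (fun a b _ => a - b),
    Complex.I / (κ * D) * cyclicSum x (fun a b c => b * (a - c) * θ a * θ c),
    1 / D * cyclicSum x (fun a _ c => (c - a) * θ a * θ c),
    -(Complex.I / (κ * D)) * cyclicSum x (fun a b c => a * θ a * (b - c))]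

/-- The block matrix `M` of the hydrodynamic equations in the `k`-aligned frame. -/
def hydroMatrix (κ : ℝ) (lsh : ℂ) (C : Fin 6 → ℂ) : Matrix (Fin 5) (Fin 5) ℂ :=
  !![0, -Complex.I * κ, 0, 0, 0;
     C 0, C 1, 0, 0, C 2;
     0, 0, lsh, 0, 0;
     0, 0, 0, lsh, 0;
     C 3, C 4, 0, 0, C 5]

/-- The minimal critical wave number `√(π/2) / τ`. -/
def kCritMin (τ : ℝ) : ℝ := Real.sqrt (Real.pi / 2) / τ

end BGK

end

noncomputable section

namespace BGK

/-! ### One-dimensional Gaussian integrals and the plasma dispersion function. -/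

section gaussian

open ProbabilityTheory Polynomial

/-! An eigenvector `f` satisfies `(lam + 1/τ + i v·k) f = τ⁻¹ ℙ₅ f`. In coordinates rotated so that
`k` points along the first axis, the left factor is `i‖k‖ (v₁ - ζ)` with `ζ = i(τ lam + 1)/(τ‖k‖)`,
and `Im ζ > 0` because `Re lam > -1/τ`. So `f` is an explicit function of its five moments `c`, and
taking moments again shows that the eigenspace is isomorphic to the solution space of `i‖k‖τ c =
G(ζ) c`, where `G` (`gram`) has entries `∫ e_i e_j / (v₁ - ζ)`. This is
`mem_eigenspace_iff_aligned`, `alignedMoments_eq_gram` and `exists_mem_eigenspace`.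

The transverse velocities decouple in `G`, each with the scalar equation `Z(ζ) = i‖k‖τ`. In the
remaining block, `v₁ = (v₁ - ζ) + ζ` yields the mass balance `c₁ = (i lam/‖k‖) c₀`, and the density
row gives `c₄ = θ(lam) c₀`, provided that `A = ζ + (ζ² - 1)Z` does not vanish. If `A = 0`, sign
properties of `Z` and `A` force `c₄ = 0`; if moreover `c₀ ≠ 0`, eliminating `Z` gives `lam² =
-‖k‖²`, impossible for `Re lam < 0`. Hence the non-shear part is at most one-dimensional: eigenspace
dimension 1 excludes `Z = i‖k‖τ`, dimension 2 forces it, and in the latter case the two transverse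
directions fill the eigenspace. This gives existence and uniqueness of the basis and `H = Q̃ A₀`,
with `A₀` the explicit `alignedMatrix`.

The rest is linear algebra. The relation `A₀ Λ = M A₀` is the mass balance in the density row and
Cramer's rule in the momentum and energy rows (`transportC_momentum`, `transportC_energy`). Reality
of the `c_j` follows from `θ(star lam) = star θ(lam)`: conjugation exchanges the two acoustic modes,
under which every cyclic expression is alternating. The dynamics closes because the generator maps
an eigenvector to a multiple of itself and taking moments is continuous and linear. -/

theorem integrable_pow_gaussian (n : ℕ) :
    Integrable (fun x : ℝ => (x : ℂ) ^ n) (gaussianReal 0 1) := by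
  have h : Integrable (fun x : ℝ => x ^ n) (gaussianReal 0 1) := by
    have := (memLp_id_gaussianReal (μ := 0) (v := 1) (n : NNReal)).integrable_norm_pow'
    refine (integrable_norm_iff (by fun_prop)).1 ?_
    simpa using this
  simpa using h.ofReal (𝕜 := ℂ)

theorem integrable_eval_gaussian (p : ℂ[X]) :
    Integrable (fun x : ℝ => p.eval (x : ℂ)) (gaussianReal 0 1) := by
  simp_rw [eval_eq_sum_range]
  exact integrable_finsetSum _ fun i _ => (integrable_pow_gaussian i).const_mul _

theorem norm_inv_sub_le {ζ : ℂ} (hζ : 0 < ζ.im) (x : ℝ) :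
    ‖((x : ℂ) - ζ)⁻¹‖ ≤ ζ.im⁻¹ := by
  rw [norm_inv]
  refine inv_anti₀ hζ ?_
  have := Complex.abs_im_le_norm ((x : ℂ) - ζ)
  simpa [abs_of_pos hζ] using this

theorem sub_ne_zero_of_im_pos {ζ : ℂ} (hζ : 0 < ζ.im) (x : ℝ) : (x : ℂ) - ζ ≠ 0 := fun h => by
  have := congrArg Complex.im h
  simp at this
  exact hζ.ne' this

theorem integrable_eval_mul_inv_sub {ζ : ℂ} (hζ : 0 < ζ.im) (p : ℂ[X]) :
    Integrable (fun x : ℝ => p.eval (x : ℂ) * ((x : ℂ) - ζ)⁻¹) (gaussianReal 0 1) :=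
  (integrable_eval_gaussian p).mul_bdd (c := ζ.im⁻¹) (by fun_prop)
    (Filter.Eventually.of_forall (norm_inv_sub_le hζ))

/-- Dividing `p - p(ζ)` by `x - ζ` under the Gaussian integral. -/
theorem integral_eval_mul_inv_sub {ζ : ℂ} (hζ : 0 < ζ.im) (p q : ℂ[X]) :
    ∫ x : ℝ, ((X - C ζ) * q + p).eval (x : ℂ) * ((x : ℂ) - ζ)⁻¹ ∂gaussianReal 0 1 =
      (∫ x : ℝ, q.eval (x : ℂ) ∂gaussianReal 0 1) +
        ∫ x : ℝ, p.eval (x : ℂ) * ((x : ℂ) - ζ)⁻¹ ∂gaussianReal 0 1 := by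
  rw [← integral_add (integrable_eval_gaussian q) (integrable_eval_mul_inv_sub hζ p)]
  refine integral_congr_ae (Filter.Eventually.of_forall fun x => ?_)
  have := sub_ne_zero_of_im_pos hζ x
  simp only [eval_add, eval_mul, eval_sub, eval_X, eval_C]
  field_simp

theorem integral_odd_gaussian (g : ℝ → ℂ) (hg : ∀ x, g (-x) = -g x) :
    ∫ x, g x ∂gaussianReal 0 1 = 0 := by
  have h : (gaussianReal 0 1).map (fun x : ℝ => -x) = gaussianReal 0 1 := by
    simp [gaussianReal_map_neg]
  have h2 : ∫ x, g x ∂gaussianReal 0 1 = ∫ x, g (-x) ∂gaussianReal 0 1 := by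
    conv_lhs => rw [← h]
    exact (MeasurableEquiv.neg ℝ).measurableEmbedding.integral_map g
  simp_rw [hg, integral_neg] at h2
  linear_combination h2 / 2

theorem integral_sq_gaussian : ∫ x : ℝ, x ^ 2 ∂gaussianReal 0 1 = 1 := by
  have h := variance_id_gaussianReal (μ := 0) (v := 1)
  rw [variance_of_integral_eq_zero (by fun_prop) (by simp)] at h
  simpa using h

theorem integral_sq_sub_one_gaussian :
    ∫ x : ℝ, ((x : ℂ) ^ 2 - 1) ∂gaussianReal 0 1 = 0 := by
  rw [integral_sub (integrable_pow_gaussian 2) (by simp)]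
  have : ∫ x : ℝ, (x : ℂ) ^ 2 ∂gaussianReal 0 1 = 1 := by
    simp_rw [← Complex.ofReal_pow]
    rw [integral_complex_ofReal, integral_sq_gaussian, Complex.ofReal_one]
  rw [this]
  simp

theorem gaussianPDFReal_zero_one (x : ℝ) :
    gaussianPDFReal 0 1 x = 1 / √(2 * Real.pi) * Real.exp (-x ^ 2 / 2) := by
  simp [gaussianPDFReal]

theorem plasmaZ_eq_integral (ζ : ℂ) :
    plasmaZ ζ = ∫ x : ℝ, ((x : ℂ) - ζ)⁻¹ ∂gaussianReal 0 1 := by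
  rw [integral_gaussianReal_eq_integral_smul one_ne_zero, plasmaZ, ← integral_const_mul]
  refine integral_congr_ae (Filter.Eventually.of_forall fun x => ?_)
  simp only [gaussianPDFReal_zero_one, Complex.real_smul, Complex.ofReal_mul]
  ring

/-- The Gaussian is even and real, so reflecting `x ↦ -x` turns the kernel at `-star ζ` into minus
the conjugate kernel at `ζ`. This is the source of the conjugation symmetry of the spectral
temperature. -/
theorem plasmaZ_neg_conj (ζ : ℂ) : plasmaZ (-star ζ) = -star (plasmaZ ζ) := by
  have h : (gaussianReal 0 1).map (fun x : ℝ => -x) = gaussianReal 0 1 := by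
    simp [gaussianReal_map_neg]
  rw [plasmaZ_eq_integral, plasmaZ_eq_integral]
  conv_lhs => rw [← h]
  refine ((MeasurableEquiv.neg ℝ).measurableEmbedding.integral_map _).trans ?_
  rw [Complex.star_def, ← integral_conj, ← integral_neg]
  refine integral_congr_ae (Filter.Eventually.of_forall fun x => ?_)
  simp only [MeasurableEquiv.neg_apply, Complex.ofReal_neg, map_inv₀, map_sub, Complex.conj_ofReal]
  rw [← inv_neg]
  congr 1
  ring

theorem integral_X_mul_inv_sub {ζ : ℂ} (hζ : 0 < ζ.im) :
    ∫ x : ℝ, (x : ℂ) * ((x : ℂ) - ζ)⁻¹ ∂gaussianReal 0 1 = 1 + ζ * plasmaZ ζ := by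
  have h := integral_eval_mul_inv_sub hζ (C ζ) 1
  simp only [eval_X, eval_C, eval_one, mul_one, sub_add_cancel,
    integral_const_mul, ← plasmaZ_eq_integral] at h
  simpa using h

theorem integral_He_mul_inv_sub {ζ : ℂ} (hζ : 0 < ζ.im) :
    ∫ x : ℝ, ((x : ℂ) ^ 2 - 1) * ((x : ℂ) - ζ)⁻¹ ∂gaussianReal 0 1 =
      ζ + (ζ ^ 2 - 1) * plasmaZ ζ := by
  -- Division with remainder: `x² - 1 = (x - ζ)(x + ζ) + (ζ² - 1)`.
  have h := integral_eval_mul_inv_sub hζ (C (ζ ^ 2 - 1)) (X + C ζ)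
  have h1 : ∫ x : ℝ, ((x : ℂ) + ζ) ∂gaussianReal 0 1 = ζ := by
    rw [integral_add (by simpa using integrable_pow_gaussian 1) (by simp),
      integral_odd_gaussian _ (by simp)]
    simp
  simp only [eval_add, eval_mul, eval_sub, eval_X, eval_C, h1,
    integral_const_mul, ← plasmaZ_eq_integral] at h
  rw [← h]
  congr 1
  ext x
  ring

theorem integral_He_sq_mul_inv_sub {ζ : ℂ} (hζ : 0 < ζ.im) :
    ∫ x : ℝ, ((x : ℂ) ^ 2 - 1) ^ 2 * ((x : ℂ) - ζ)⁻¹ ∂gaussianReal 0 1 =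
      (ζ ^ 2 - 1) * (ζ + (ζ ^ 2 - 1) * plasmaZ ζ) := by
  have h := integral_eval_mul_inv_sub hζ (C (ζ ^ 2 - 1) * (X ^ 2 - 1)) ((X + C ζ) * (X ^ 2 - 1))
  have i1 := integrable_eval_gaussian (X * (X ^ 2 - 1))
  have i2 := integrable_eval_gaussian (C ζ * (X ^ 2 - 1))
  simp only [eval_mul, eval_sub, eval_X, eval_C, eval_pow, eval_one] at i1 i2
  -- The quotient integrates to zero: `x² - 1` is a Hermite polynomial, orthogonal to polynomials of
  -- degree at most one.
  have h1 : ∫ x : ℝ, ((x : ℂ) + ζ) * ((x : ℂ) ^ 2 - 1) ∂gaussianReal 0 1 = 0 := by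
    simp_rw [add_mul]
    rw [integral_add i1 i2, integral_odd_gaussian _ (by intro x; push_cast; ring),
      integral_const_mul, integral_sq_sub_one_gaussian]
    simp
  simp only [eval_add, eval_mul, eval_sub, eval_X, eval_C, eval_pow, eval_one, h1, mul_assoc,
    integral_const_mul, integral_He_mul_inv_sub hζ, zero_add] at h
  rw [← h]
  congr 1
  ext x
  ring

/-! ### Strict signs of the plasma dispersion function and of `ζ + (ζ² - 1)Z`. -/

theorem integral_neg_of_neg_off_countable {μ : Measure ℝ} [NullSingletonClass μ] (hμ : μ ≠ 0)
    {g : ℝ → ℝ} (hg : Integrable g μ) {s : Set ℝ} (hs : s.Countable) (h : ∀ x, x ∉ s → g x < 0) :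
    ∫ x, g x ∂μ < 0 := by
  have hs0 : μ s = 0 := hs.measure_zero μ
  have hae : ∀ᵐ x ∂μ, x ∉ s := measure_eq_zero_iff_ae_notMem.1 hs0
  rw [← neg_pos, ← integral_neg]
  refine (integral_pos_iff_support_of_nonneg_ae
    (by filter_upwards [hae] with x hx using by simpa using (h x hx).le) hg.neg).2 ?_
  have hsub : sᶜ ⊆ Function.support fun x => -g x := fun x hx => by
    simpa using (h x hx).ne
  refine lt_of_lt_of_le ?_ (measure_mono hsub)
  refine pos_iff_ne_zero.2 fun h0 => hμ (Measure.measure_univ_eq_zero.1 ?_)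
  rw [← Set.union_compl_self s]
  exact measure_union_null hs0 h0

theorem re_inv_sub (ζ : ℂ) (x : ℝ) :
    (((x : ℂ) - ζ)⁻¹).re = (x - ζ.re) / ((x - ζ.re) ^ 2 + ζ.im ^ 2) := by
  simp [Complex.inv_re, Complex.normSq_apply, sq]

theorem im_inv_sub (ζ : ℂ) (x : ℝ) :
    (((x : ℂ) - ζ)⁻¹).im = ζ.im / ((x - ζ.re) ^ 2 + ζ.im ^ 2) := by
  simp [Complex.inv_im, Complex.normSq_apply, sq]

/-- The real part of the kernel is odd about `Re ζ`. Of two points symmetric about `Re ζ > 0`, the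
left one is closer to the origin and carries the larger Gaussian weight, and there the kernel is
negative. -/
theorem re_plasmaZ_neg {ζ : ℂ} (hζ : 0 < ζ.im) (hre : 0 < ζ.re) : (plasmaZ ζ).re < 0 := by
  set g : ℝ → ℝ := fun v => gaussianPDFReal 0 1 v * ((v - ζ.re) / ((v - ζ.re) ^ 2 + ζ.im ^ 2))
    with hgdef
  have hi : Integrable (fun x : ℝ => ((x : ℂ) - ζ)⁻¹) (gaussianReal 0 1) := by
    simpa using integrable_eval_mul_inv_sub hζ 1
  have hi' : Integrable (fun x : ℝ => (x - ζ.re) / ((x - ζ.re) ^ 2 + ζ.im ^ 2))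
      (gaussianReal 0 1) := by
    simpa only [RCLike.re_to_complex, re_inv_sub] using hi.re
  have hg : Integrable g := by
    rw [gaussianReal_of_var_ne_zero 0 one_ne_zero, gaussianPDF_def,
      integrable_withDensity_iff_integrable_smul' (by fun_prop) (by simp)] at hi'
    refine hi'.congr (Filter.Eventually.of_forall fun x => ?_)
    simp only [hgdef, smul_eq_mul, ENNReal.toReal_ofReal (gaussianPDFReal_nonneg 0 1 x)]
  have hJ : (plasmaZ ζ).re = ∫ v, g v := by
    have h1 := integral_re hi
    simp only [RCLike.re_to_complex, re_inv_sub] at h1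
    rw [plasmaZ_eq_integral, ← h1, integral_gaussianReal_eq_integral_smul one_ne_zero]
    rfl
  -- Symmetrize about `Re ζ`, using translation and reflection invariance of Lebesgue measure.
  have h2 : 2 * ∫ v, g v = ∫ u, (g (u + ζ.re) + g (ζ.re - u)) := by
    rw [integral_add (hg.comp_add_right _) (hg.comp_sub_left _), integral_add_right_eq_self,
      integral_sub_left_eq_self]
    ring
  have h3 : ∫ u, (g (u + ζ.re) + g (ζ.re - u)) < 0 := by
    refine integral_neg_of_neg_off_countable (NeZero.ne _)
      ((hg.comp_add_right _).add (hg.comp_sub_left _)) (s := {0}) (by simp) fun u hu => ?_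
    have hu : u ≠ 0 := hu
    have hd : 0 < u ^ 2 + ζ.im ^ 2 := by positivity
    have h4 : g (u + ζ.re) + g (ζ.re - u) = 1 / √(2 * Real.pi) / (u ^ 2 + ζ.im ^ 2) *
        (u * (Real.exp (-(u + ζ.re) ^ 2 / 2) - Real.exp (-(ζ.re - u) ^ 2 / 2))) := by
      simp only [hgdef, gaussianPDFReal_zero_one, add_sub_cancel_right,
        show ζ.re - u - ζ.re = -u by ring, neg_sq]
      ring
    rw [h4]
    refine mul_neg_of_pos_of_neg (by positivity) ?_
    rcases lt_or_gt_of_ne hu with h | h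
    · refine mul_neg_of_neg_of_pos h (sub_pos.2 (Real.exp_lt_exp.2 ?_))
      nlinarith
    · refine mul_neg_of_pos_of_neg h (sub_neg.2 (Real.exp_lt_exp.2 ?_))
      nlinarith
  rw [hJ]
  linarith

theorem re_eq_zero_of_re_plasmaZ_eq_zero {ζ : ℂ} (hζ : 0 < ζ.im) (h : (plasmaZ ζ).re = 0) :
    ζ.re = 0 := by
  rcases lt_trichotomy ζ.re 0 with hr | hr | hr
  · have := re_plasmaZ_neg (ζ := -star ζ) (by simpa using hζ) (by simpa using hr)
    rw [plasmaZ_neg_conj] at this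
    simp [h] at this
  · exact hr
  · exact absurd h (re_plasmaZ_neg hζ hr).ne

/-- On the imaginary axis the imaginary part is `∫ (x² - 1) η/(x² + η²)` with `η = Im ζ`. Since `x²
- 1` has mean zero and the kernel decreases in `x²`, this integral is strictly negative. -/
theorem add_sq_sub_one_mul_plasmaZ_ne_zero {ζ : ℂ} (hζ : 0 < ζ.im) (hre : ζ.re = 0) :
    ζ + (ζ ^ 2 - 1) * plasmaZ ζ ≠ 0 := by
  have hi : Integrable (fun x : ℝ => ((x : ℂ) ^ 2 - 1) * ((x : ℂ) - ζ)⁻¹) (gaussianReal 0 1) := by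
    have := integrable_eval_mul_inv_sub hζ (X ^ 2 - 1 : ℂ[X])
    simpa only [eval_sub, eval_pow, eval_X, eval_one] using this
  have him : ∀ x : ℝ, (((x : ℂ) ^ 2 - 1) * ((x : ℂ) - ζ)⁻¹).im =
      (x ^ 2 - 1) * (ζ.im / (x ^ 2 + ζ.im ^ 2)) := fun x => by
    have : ((x : ℂ) ^ 2 - 1) = ((x ^ 2 - 1 : ℝ) : ℂ) := by push_cast; ring
    rw [this, Complex.im_ofReal_mul, im_inv_sub, hre, sub_zero]
  have hi1 : Integrable (fun x : ℝ => (x ^ 2 - 1) * (ζ.im / (x ^ 2 + ζ.im ^ 2)))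
      (gaussianReal 0 1) := by
    simpa only [RCLike.im_to_complex, him] using hi.im
  have hi2 : Integrable (fun x : ℝ => (x ^ 2 - 1) * (ζ.im / (1 + ζ.im ^ 2)))
      (gaussianReal 0 1) := by
    refine Integrable.mul_const (Integrable.sub ?_ (by simp)) _
    simpa [← Complex.ofReal_pow] using (integrable_pow_gaussian 2).re
  have h2 : ∫ x : ℝ, (x ^ 2 - 1) * (ζ.im / (1 + ζ.im ^ 2)) ∂gaussianReal 0 1 = 0 := by
    rw [integral_mul_const, integral_sub (by
      simpa [← Complex.ofReal_pow] using (integrable_pow_gaussian 2).re) (by simp),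
      integral_sq_gaussian]
    simp
  -- Subtracting the kernel's value at `x² = 1` costs nothing, by `h2`, and makes the integrand
  -- negative off `x = ±1`.
  have hlt : ∫ x : ℝ, ((x ^ 2 - 1) * (ζ.im / (x ^ 2 + ζ.im ^ 2)) -
      (x ^ 2 - 1) * (ζ.im / (1 + ζ.im ^ 2))) ∂gaussianReal 0 1 < 0 := by
    have : NullSingletonClass (gaussianReal 0 1) := nullSingletonClass_gaussianReal one_ne_zero
    refine integral_neg_of_neg_off_countable (IsProbabilityMeasure.ne_zero _) (hi1.sub hi2)
      (s := {1, -1}) (by simp) fun x hx => ?_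
    have hx2 : x ^ 2 - 1 ≠ 0 := fun h => hx (by
      simpa using sq_eq_one_iff.1 (sub_eq_zero.1 h))
    have h5 : (x ^ 2 - 1) * (ζ.im / (x ^ 2 + ζ.im ^ 2)) - (x ^ 2 - 1) * (ζ.im / (1 + ζ.im ^ 2)) =
        -(ζ.im * (x ^ 2 - 1) ^ 2 / ((x ^ 2 + ζ.im ^ 2) * (1 + ζ.im ^ 2))) := by
      field_simp
      ring
    rw [h5, neg_lt_zero]
    positivity
  rw [integral_sub hi1 hi2, h2, sub_zero] at hlt
  intro h0
  rw [← integral_He_mul_inv_sub hζ] at h0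
  have h6 := integral_im hi
  simp only [RCLike.im_to_complex, him, h0, Complex.zero_im] at h6
  exact hlt.ne h6

/-! ### The Maxwellian as a standard Gaussian, and the Gram matrix of the resolvent kernel. -/

instance isFiniteMeasure_maxwellian : IsFiniteMeasure maxwellian := by
  have h := (memLp_two_iff_integrable_sq_norm (memLp_eFun 0).1).1 (memLp_eFun 0)
  have h1 : Integrable (fun _ : R3 => (1 : ℝ)) maxwellian := by
    simpa [eFun] using h
  exact (integrable_const_iff_isFiniteMeasure one_ne_zero).1 h1

/-- Both characteristic functions are `exp(-‖t‖²/2)`. The identification supplies the product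
structure and the rotation invariance of the Maxwellian. -/
theorem maxwellian_eq_stdGaussian : maxwellian = stdGaussian R3 := by
  apply Measure.ext_of_charFun
  ext t
  rw [charFun_stdGaussian, charFun_apply, maxwellian,
    integral_withDensity_eq_integral_toReal_smul (by fun_prop) (by simp)]
  have h := GaussianFourier.integral_cexp_neg_mul_sq_norm_add (V := R3) (b := 1 / 2)
    (by simp) Complex.I t
  have hpos : ∀ v : R3,
      0 ≤ (2 * Real.pi) ^ (-(3 : ℝ) / 2) * Real.exp (-‖v‖ ^ 2 / 2) := by
    intro v; positivity
  have h2 : ∀ v : R3, (ENNReal.ofReal ((2 * Real.pi) ^ (-(3 : ℝ) / 2) *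
      Real.exp (-‖v‖ ^ 2 / 2))).toReal • Complex.exp ((inner ℝ v t : ℝ) * Complex.I) =
      (((2 * Real.pi) ^ (-(3 : ℝ) / 2) : ℝ) : ℂ) *
        Complex.exp (-(1 / 2) * (‖v‖ : ℂ) ^ 2 + Complex.I * (inner ℝ t v : ℝ)) := fun v => by
    rw [ENNReal.toReal_ofReal (hpos v), Complex.real_smul, Complex.ofReal_mul, mul_assoc,
      Complex.ofReal_exp, ← Complex.exp_add, real_inner_comm]
    congr 2
    push_cast
    ring
  simp_rw [h2]
  rw [integral_const_mul, h]
  have h3 : ((Real.pi : ℂ) / (1 / 2)) ^ ((Module.finrank ℝ R3 : ℂ) / 2) =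
      (((2 * Real.pi) ^ ((3 : ℝ) / 2) : ℝ) : ℂ) := by
    rw [Complex.ofReal_cpow (by positivity)]
    simp [mul_comm]
  rw [h3, ← mul_assoc, ← Complex.ofReal_mul, ← Real.rpow_add (by positivity)]
  rw [show (-(3 : ℝ) / 2 + 3 / 2) = 0 by ring, Real.rpow_zero, Complex.ofReal_one, one_mul,
    Complex.I_sq]
  congr 1
  ring

theorem map_pi_eq_maxwellian :
    (Measure.pi fun _ : Fin 3 => gaussianReal 0 1).map (WithLp.toLp 2) = maxwellian := by
  rw [map_pi_eq_stdGaussian, maxwellian_eq_stdGaussian]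

theorem measurePreserving_maxwellian (R : R3 ≃ₗᵢ[ℝ] R3) :
    MeasurePreserving R maxwellian maxwellian := by
  refine ⟨R.continuous.measurable, ?_⟩
  rw [maxwellian_eq_stdGaussian]
  exact stdGaussian_map R

theorem integral_maxwellian_eq (g : R3 → ℂ) :
    ∫ v, g v ∂maxwellian =
      ∫ x, g (WithLp.toLp 2 x) ∂(Measure.pi fun _ : Fin 3 => gaussianReal 0 1) := by
  rw [← map_pi_eq_maxwellian]
  exact (MeasurableEquiv.toLp 2 (Fin 3 → ℝ)).measurableEmbedding.integral_map g

theorem integral_tensor (φ ψ χ : ℝ → ℂ) :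
    ∫ v : R3, φ (v 0) * ψ (v 1) * χ (v 2) ∂maxwellian =
      (∫ x, φ x ∂gaussianReal 0 1) * (∫ x, ψ x ∂gaussianReal 0 1) *
        ∫ x, χ x ∂gaussianReal 0 1 := by
  rw [integral_maxwellian_eq]
  have h := integral_fintype_prod_eq_prod (𝕜 := ℂ) (![φ, ψ, χ])
    (μ := fun _ : Fin 3 => gaussianReal 0 1)
  simpa [Fin.prod_univ_three] using h

theorem integrable_tensor {φ ψ χ : ℝ → ℂ} (hφ : Integrable φ (gaussianReal 0 1))
    (hψ : Integrable ψ (gaussianReal 0 1)) (hχ : Integrable χ (gaussianReal 0 1)) :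
    Integrable (fun v : R3 => φ (v 0) * ψ (v 1) * χ (v 2)) maxwellian := by
  rw [← map_pi_eq_maxwellian]
  refine ((MeasurableEquiv.toLp 2 (Fin 3 → ℝ)).measurableEmbedding.integrable_map_iff).2 ?_
  have h := Integrable.fintype_prod (𝕜 := ℂ) (f := ![φ, ψ, χ])
    (μ := fun _ : Fin 3 => gaussianReal 0 1)
    (by intro i; fin_cases i <;> simpa)
  simpa [Fin.prod_univ_three, Function.comp_def] using h

/-- The integral of `e_i e_j / (v₁ - ζ)` against the Maxwellian. -/
def gram (ζ : ℂ) (i j : Fin 5) : ℂ :=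
  ∫ v, eFun i v * eFun j v * (((v 0 : ℝ) : ℂ) - ζ)⁻¹ ∂maxwellian

theorem gram_comm (ζ : ℂ) (i j : Fin 5) : gram ζ i j = gram ζ j i := by
  simp only [gram, mul_comm (eFun i _)]

/-- The integral of `p(v₁) q(v₂) r(v₃) / (v₁ - ζ)` against the Maxwellian, for polynomials. -/
theorem integral_polynomial {ζ : ℂ} (p q r : ℂ[X]) :
    ∫ v : R3, p.eval ((v 0 : ℝ) : ℂ) * (((v 0 : ℝ) : ℂ) - ζ)⁻¹ * q.eval ((v 1 : ℝ) : ℂ) *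
      r.eval ((v 2 : ℝ) : ℂ) ∂maxwellian =
      (∫ x : ℝ, p.eval (x : ℂ) * ((x : ℂ) - ζ)⁻¹ ∂gaussianReal 0 1) *
        (∫ x : ℝ, q.eval (x : ℂ) ∂gaussianReal 0 1) *
        ∫ x : ℝ, r.eval (x : ℂ) ∂gaussianReal 0 1 :=
  integral_tensor (fun x => p.eval (x : ℂ) * ((x : ℂ) - ζ)⁻¹) (fun x => q.eval (x : ℂ))
    fun x => r.eval (x : ℂ)

theorem integrable_polynomial {ζ : ℂ} (hζ : 0 < ζ.im) (p q r : ℂ[X]) :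
    Integrable (fun v : R3 => p.eval ((v 0 : ℝ) : ℂ) * (((v 0 : ℝ) : ℂ) - ζ)⁻¹ *
      q.eval ((v 1 : ℝ) : ℂ) * r.eval ((v 2 : ℝ) : ℂ)) maxwellian :=
  integrable_tensor (φ := fun x => p.eval (x : ℂ) * ((x : ℂ) - ζ)⁻¹)
    (ψ := fun x => q.eval (x : ℂ)) (χ := fun x => r.eval (x : ℂ))
    (integrable_eval_mul_inv_sub hζ p) (integrable_eval_gaussian q) (integrable_eval_gaussian r)

/-- Integrals of finite sums of tensor products of polynomials. -/
theorem integral_sum_polynomial {ζ : ℂ} (hζ : 0 < ζ.im) {n : ℕ} (p q r : Fin n → ℂ[X])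
    {g : R3 → ℂ} (hg : ∀ v, g v = ∑ l, (p l).eval ((v 0 : ℝ) : ℂ) * (q l).eval ((v 1 : ℝ) : ℂ) *
      (r l).eval ((v 2 : ℝ) : ℂ)) :
    ∫ v, g v * (((v 0 : ℝ) : ℂ) - ζ)⁻¹ ∂maxwellian =
      ∑ l, (∫ x : ℝ, (p l).eval (x : ℂ) * ((x : ℂ) - ζ)⁻¹ ∂gaussianReal 0 1) *
        (∫ x : ℝ, (q l).eval (x : ℂ) ∂gaussianReal 0 1) *
        ∫ x : ℝ, (r l).eval (x : ℂ) ∂gaussianReal 0 1 := by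
  simp_rw [← integral_polynomial]
  rw [← integral_finsetSum _ fun l _ => integrable_polynomial hζ (p l) (q l) (r l)]
  refine integral_congr_ae (Filter.Eventually.of_forall fun v => ?_)
  simp only [hg, Finset.sum_mul]
  refine Finset.sum_congr rfl fun l _ => ?_
  ring

theorem eFun_four (v : R3) : eFun 4 v =
    (((v 0 : ℝ) : ℂ) ^ 2 - 1 + (((v 1 : ℝ) : ℂ) ^ 2 - 1) + (((v 2 : ℝ) : ℂ) ^ 2 - 1)) / (√6 : ℝ) := by
  change (((‖v‖ ^ 2 - 3) / √6 : ℝ) : ℂ) = _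
  rw [EuclideanSpace.real_norm_sq_eq, Fin.sum_univ_three]
  push_cast
  ring

@[simp] theorem eFun_zero (v : R3) : eFun 0 v = 1 := rfl
@[simp] theorem eFun_one (v : R3) : eFun 1 v = ((v 0 : ℝ) : ℂ) := rfl
@[simp] theorem eFun_two (v : R3) : eFun 2 v = ((v 1 : ℝ) : ℂ) := rfl
@[simp] theorem eFun_three (v : R3) : eFun 3 v = ((v 2 : ℝ) : ℂ) := rfl

theorem sqrt_six_sq : ((√6 : ℝ) : ℂ) ^ 2 = 6 := by
  rw [← Complex.ofReal_pow, Real.sq_sqrt (by norm_num)]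
  norm_num

theorem sqrt_six_ne_zero : ((√6 : ℝ) : ℂ) ≠ 0 := fun h => by
  simpa [h] using sqrt_six_sq

theorem integral_X_gaussian : ∫ x : ℝ, (x : ℂ) ∂gaussianReal 0 1 = 0 :=
  integral_odd_gaussian _ (by simp)

theorem integral_X_mul_He_gaussian : ∫ x : ℝ, (x : ℂ) * ((x : ℂ) ^ 2 - 1) ∂gaussianReal 0 1 = 0 :=
  integral_odd_gaussian _ (by intro x; push_cast; ring)

theorem gram_zero_zero (ζ : ℂ) : gram ζ 0 0 = plasmaZ ζ := by
  have := integral_polynomial (ζ := ζ) 1 1 1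
  simpa [gram, plasmaZ_eq_integral] using this

theorem integral_eFun (j : Fin 5) : ∫ v, eFun j v ∂maxwellian = if j = 0 then 1 else 0 := by
  have h1 := integrable_eval_gaussian 1
  have h2 := integrable_eval_gaussian (X ^ 2 - 1 : ℂ[X])
  simp only [eval_sub, eval_pow, eval_X, eval_one] at h1 h2
  fin_cases j
  · simpa using integral_tensor (fun _ => 1) (fun _ => 1) fun _ => 1
  · simpa [integral_X_gaussian] using integral_tensor (fun x => x) (fun _ => 1) fun _ => 1
  · simpa [integral_X_gaussian] using integral_tensor (fun _ => 1) (fun x => x) fun _ => 1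
  · simpa [integral_X_gaussian] using integral_tensor (fun _ => 1) (fun _ => 1) fun x => x
  · have i1 := integrable_tensor h2 h1 h1
    have i2 := integrable_tensor h1 h2 h1
    have i3 := integrable_tensor h1 h1 h2
    have e1 := integral_tensor (fun x => (x : ℂ) ^ 2 - 1) (fun _ => 1) fun _ => 1
    have e2 := integral_tensor (fun _ => 1) (fun x => (x : ℂ) ^ 2 - 1) fun _ => 1
    have e3 := integral_tensor (fun _ => 1) (fun _ => 1) fun x => (x : ℂ) ^ 2 - 1
    simp only [mul_one, one_mul, integral_sq_sub_one_gaussian, zero_mul, mul_zero]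
      at i1 i2 i3 e1 e2 e3
    change ∫ v, eFun 4 v ∂maxwellian = 0
    simp_rw [eFun_four]
    rw [integral_div, integral_add (by exact i1.add i2) i3, integral_add i1 i2, e1, e2, e3]
    simp

/-! ### Entries of the Gram matrix. -/

section entries

variable {ζ : ℂ} (hζ : 0 < ζ.im)
include hζ

theorem gram_zero_one : gram ζ 0 1 = 1 + ζ * plasmaZ ζ := by
  have := integral_polynomial (ζ := ζ) X 1 1
  simpa [gram, integral_X_mul_inv_sub hζ] using this

theorem gram_zero_two : gram ζ 0 2 = 0 := by
  have := integral_sum_polynomial hζ ![1] ![X] ![1] (g := fun v => eFun 0 v * eFun 2 v) (by simp)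
  simpa [gram, integral_X_gaussian] using this

theorem gram_zero_three : gram ζ 0 3 = 0 := by
  have := integral_sum_polynomial hζ ![1] ![1] ![X] (g := fun v => eFun 0 v * eFun 3 v) (by simp)
  simpa [gram, integral_X_gaussian] using this

theorem gram_two_two : gram ζ 2 2 = plasmaZ ζ := by
  have := integral_sum_polynomial hζ ![1, 1] ![X ^ 2 - 1, 1] ![1, 1]
    (g := fun v => eFun 2 v * eFun 2 v) (by intro v; simp [Fin.sum_univ_two]; ring)
  simpa [gram, integral_sq_sub_one_gaussian, plasmaZ_eq_integral] using this

theorem gram_three_three : gram ζ 3 3 = plasmaZ ζ := by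
  have := integral_sum_polynomial hζ ![1, 1] ![1, 1] ![X ^ 2 - 1, 1]
    (g := fun v => eFun 3 v * eFun 3 v) (by intro v; simp [Fin.sum_univ_two]; ring)
  simpa [gram, integral_sq_sub_one_gaussian, plasmaZ_eq_integral] using this

theorem gram_two_three : gram ζ 2 3 = 0 := by
  have := integral_sum_polynomial hζ ![1] ![X] ![X] (g := fun v => eFun 2 v * eFun 3 v) (by simp)
  simpa [gram, integral_X_gaussian] using this

theorem gram_zero_four : gram ζ 0 4 = (ζ + (ζ ^ 2 - 1) * plasmaZ ζ) / (√6 : ℝ) := by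
  have := integral_sum_polynomial hζ ![C (1 / (√6 : ℝ) : ℂ) * (X ^ 2 - 1), C (1 / (√6 : ℝ) : ℂ),
      C (1 / (√6 : ℝ) : ℂ)] ![1, X ^ 2 - 1, 1] ![1, 1, X ^ 2 - 1]
    (g := fun v => eFun 0 v * eFun 4 v) (by intro v; simp [Fin.sum_univ_three, eFun_four]; ring)
  simp only [Fin.sum_univ_three, Matrix.cons_val, eval_mul, eval_C, eval_sub, eval_X, eval_one,
    eval_pow, integral_sq_sub_one_gaussian, mul_assoc, integral_const_mul,
    integral_He_mul_inv_sub hζ] at this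
  rw [gram]
  simp only [mul_assoc]
  rw [this]
  simp
  ring

theorem gram_two_four : gram ζ 2 4 = 0 := by
  have := integral_sum_polynomial hζ ![C (1 / (√6 : ℝ) : ℂ) * (X ^ 2 - 1), C (1 / (√6 : ℝ) : ℂ),
      C (1 / (√6 : ℝ) : ℂ)] ![X, X * (X ^ 2 - 1), X] ![1, 1, X ^ 2 - 1]
    (g := fun v => eFun 2 v * eFun 4 v) (by intro v; simp [Fin.sum_univ_three, eFun_four]; ring)
  simp only [Fin.sum_univ_three, Matrix.cons_val, eval_mul, eval_C, eval_sub, eval_X, eval_one,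
    eval_pow, integral_X_mul_He_gaussian, integral_X_gaussian, mul_zero, zero_mul, add_zero] at this
  exact this

theorem gram_three_four : gram ζ 3 4 = 0 := by
  have := integral_sum_polynomial hζ ![C (1 / (√6 : ℝ) : ℂ) * (X ^ 2 - 1), C (1 / (√6 : ℝ) : ℂ),
      C (1 / (√6 : ℝ) : ℂ)] ![1, X ^ 2 - 1, 1] ![X, X, X * (X ^ 2 - 1)]
    (g := fun v => eFun 3 v * eFun 4 v) (by intro v; simp [Fin.sum_univ_three, eFun_four]; ring)
  simp only [Fin.sum_univ_three, Matrix.cons_val, eval_mul, eval_C, eval_sub, eval_X, eval_one,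
    eval_pow, integral_X_mul_He_gaussian, integral_X_gaussian, mul_zero, add_zero] at this
  exact this

/-- Square the sum of the three `v_i² - 1`: every term with an unsquared transverse factor has mean
zero. Only the reality of the coefficient `m` matters later, not its value. -/
theorem exists_gram_four_four : ∃ m : ℝ, gram ζ 4 4 =
    ((ζ ^ 2 - 1) * (ζ + (ζ ^ 2 - 1) * plasmaZ ζ) + m * plasmaZ ζ) / 6 := by
  refine ⟨2 * ∫ x : ℝ, (x ^ 2 - 1) ^ 2 ∂gaussianReal 0 1, ?_⟩
  have hm : ∫ x : ℝ, ((x : ℂ) ^ 2 - 1) ^ 2 ∂gaussianReal 0 1 =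
      ((∫ x : ℝ, (x ^ 2 - 1) ^ 2 ∂gaussianReal 0 1 : ℝ) : ℂ) := by
    rw [← integral_complex_ofReal]
    push_cast
    rfl
  have hC : ∀ v : R3, eFun 4 v * eFun 4 v = (1 / 6) *
      ((((v 0 : ℝ) : ℂ) ^ 2 - 1 + (((v 1 : ℝ) : ℂ) ^ 2 - 1) + (((v 2 : ℝ) : ℂ) ^ 2 - 1)) ^ 2) :=
    fun v => by
      rw [eFun_four, ← sqrt_six_sq]
      have := sqrt_six_ne_zero
      field_simp
  have := integral_sum_polynomial hζ
    ![C (1 / 6) * (X ^ 2 - 1) ^ 2, C (1 / 3) * (X ^ 2 - 1), C (1 / 3) * (X ^ 2 - 1), C (1 / 6),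
      C (1 / 6), C (1 / 3)]
    ![1, X ^ 2 - 1, 1, (X ^ 2 - 1) ^ 2, 1, X ^ 2 - 1]
    ![1, 1, X ^ 2 - 1, 1, (X ^ 2 - 1) ^ 2, X ^ 2 - 1]
    (g := fun v => eFun 4 v * eFun 4 v)
    (by intro v; rw [hC]; simp [Fin.sum_univ_six]; ring)
  simp only [Fin.sum_univ_six, Matrix.cons_val, eval_mul, eval_C, eval_sub, eval_X, eval_one,
    eval_pow, integral_sq_sub_one_gaussian, mul_assoc, integral_const_mul,
    integral_He_sq_mul_inv_sub hζ, hm, ← plasmaZ_eq_integral] at this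
  rw [gram]
  simp only [mul_assoc]
  rw [this]
  simp
  ring

theorem integrable_eFun_mul_eFun_mul (i j : Fin 5) :
    Integrable (fun v : R3 => eFun i v * eFun j v * (((v 0 : ℝ) : ℂ) - ζ)⁻¹) maxwellian :=
  ((memLp_eFun i).integrable_mul (memLp_eFun j)).mul_bdd (c := ζ.im⁻¹)
    (by fun_prop) (Filter.Eventually.of_forall fun v => norm_inv_sub_le hζ (v 0))

/-- Write `v₁ = (v₁ - ζ) + ζ`: the first summand cancels the kernel and leaves the mean of `e_j`.
Row 1 thus reduces to row 0, which is what produces the mass balance. -/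
theorem gram_one (j : Fin 5) :
    gram ζ 1 j = (if j = 0 then 1 else 0) + ζ * gram ζ 0 j := by
  rw [← integral_eFun, gram, gram, ← integral_const_mul, ← integral_add]
  · refine integral_congr_ae (Filter.Eventually.of_forall fun v => ?_)
    have := sub_ne_zero_of_im_pos hζ (v 0)
    simp only [eFun_one, eFun_zero]
    field_simp
    ring
  · exact (memLp_eFun j).integrable (by norm_num)
  · exact (integrable_eFun_mul_eFun_mul hζ 0 j).const_mul _

end entries

end gaussian

/-! ### Rotation to coordinates aligned with the wave vector. -/

theorem Qtilde_mul_transpose {Q : Matrix (Fin 3) (Fin 3) ℝ} (h : Q * Q.transpose = 1) :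
    Qtilde Q * (Qtilde Q).transpose = 1 := by
  have hh : ∀ i j, (Q i 0 : ℂ) * Q j 0 + Q i 1 * Q j 1 + Q i 2 * Q j 2 = if i = j then 1 else 0 :=
    fun i j => by
      have := congrFun (congrFun h i) j
      simp only [Matrix.mul_apply, Matrix.one_apply, Fin.sum_univ_three,
        Matrix.transpose_apply] at this
      have h' := congrArg Complex.ofReal this
      push_cast [apply_ite Complex.ofReal] at h'
      exact h'
  ext i j
  rw [Matrix.mul_apply, Fin.sum_univ_five]
  fin_cases i <;> fin_cases j <;> simp [Qtilde, hh]

theorem transpose_mul_Qtilde {Q : Matrix (Fin 3) (Fin 3) ℝ} (h : Q * Q.transpose = 1) :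
    (Qtilde Q).transpose * Qtilde Q = 1 :=
  mul_eq_one_comm.1 (Qtilde_mul_transpose h)

theorem det_Qtilde {Q : Matrix (Fin 3) (Fin 3) ℝ} (h : Q.det = 1) : (Qtilde Q).det = 1 := by
  have hdet : (!![1, 0, 0, 0, 0;
      0, Q 0 0, Q 0 1, Q 0 2, 0;
      0, Q 1 0, Q 1 1, Q 1 2, 0;
      0, Q 2 0, Q 2 1, Q 2 2, 0;
      0, 0, 0, 0, 1] : Matrix (Fin 5) (Fin 5) ℝ).det = 1 := by
    rw [Matrix.det_fin_three] at h
    simp [Matrix.det_succ_row_zero, Fin.sum_univ_succ, Fin.succAbove]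
    linear_combination h
  have := Complex.ofRealHom.map_det (!![1, 0, 0, 0, 0;
      0, Q 0 0, Q 0 1, Q 0 2, 0;
      0, Q 1 0, Q 1 1, Q 1 2, 0;
      0, Q 2 0, Q 2 1, Q 2 2, 0;
      0, 0, 0, 0, 1] : Matrix (Fin 5) (Fin 5) ℝ)
  rw [hdet, map_one] at this
  exact this.symm

theorem IsAligning.mul_transpose {k : R3} {Q : Matrix (Fin 3) (Fin 3) ℝ} (hQ : IsAligning k Q) :
    Q * Q.transpose = 1 :=
  (Matrix.mem_orthogonalGroup_iff _ _).1 (Matrix.mem_specialOrthogonalGroup_iff.1 hQ.1).1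

theorem IsAligning.det_eq_one {k : R3} {Q : Matrix (Fin 3) (Fin 3) ℝ} (hQ : IsAligning k Q) :
    Q.det = 1 :=
  (Matrix.mem_specialOrthogonalGroup_iff.1 hQ.1).2

/-- The change to `k`-aligned coordinates `v ↦ Qᵀ v`, as an isometry. -/
def rotation {Q : Matrix (Fin 3) (Fin 3) ℝ} (h : Q * Q.transpose = 1) : R3 ≃ₗᵢ[ℝ] R3 :=
  LinearIsometry.toLinearIsometryEquiv
    { toLinearMap := Matrix.toEuclideanLin Q.transpose
      norm_map' := fun v => by
        rw [← sq_eq_sq₀ (norm_nonneg _) (norm_nonneg _), EuclideanSpace.real_norm_sq_eq,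
          EuclideanSpace.real_norm_sq_eq]
        have h1 : ∀ w : Fin 3 → ℝ, ∑ i, w i ^ 2 = w ⬝ᵥ w := fun w => by
          simp [dotProduct, sq]
        rw [h1, h1 v.ofLp]
        have h2 : (Matrix.toEuclideanLin Q.transpose v).ofLp = Q.transpose.mulVec v.ofLp := rfl
        rw [h2, Matrix.dotProduct_mulVec, Matrix.vecMul_transpose, Matrix.mulVec_mulVec, h,
          Matrix.one_mulVec] } rfl

theorem rotation_apply {Q : Matrix (Fin 3) (Fin 3) ℝ} (h : Q * Q.transpose = 1) (v : R3)
    (j : Fin 3) : rotation h v j = Q 0 j * v 0 + Q 1 j * v 1 + Q 2 j * v 2 := by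
  change Q.transpose.mulVec v.ofLp j = _
  simp [Matrix.mulVec, dotProduct, Fin.sum_univ_three]

theorem eFun_rotation {Q : Matrix (Fin 3) (Fin 3) ℝ} (h : Q * Q.transpose = 1) (v : R3) :
    (fun j => eFun j (rotation h v)) = (Qtilde Q).transpose.mulVec fun i => eFun i v := by
  ext j
  have h4 : eFun 4 (rotation h v) = eFun 4 v := by
    change (((‖rotation h v‖ ^ 2 - 3) / √6 : ℝ) : ℂ) = (((‖v‖ ^ 2 - 3) / √6 : ℝ) : ℂ)
    rw [LinearIsometryEquiv.norm_map]
  fin_cases j <;>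
    simp [Matrix.mulVec, dotProduct, Fin.sum_univ_five, Qtilde, rotation_apply, h4]

/-- Alignment says that `k` is `‖k‖` times the first column of `Q`. -/
theorem inner_eq_rotation {k : R3} {Q : Matrix (Fin 3) (Fin 3) ℝ} (hQ : IsAligning k Q) (v : R3) :
    (inner ℝ v k : ℝ) = ‖k‖ * rotation hQ.mul_transpose v 0 := by
  have hk : ∀ i, k i = Q i 0 * ‖k‖ := fun i => by
    rw [← congrFun hQ.2 i]
    simp [Matrix.mulVec, dotProduct, Fin.sum_univ_three]
  rw [rotation_apply, PiLp.inner_apply, Fin.sum_univ_three]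
  simp [hk]
  ring

theorem moments_eq_integral (f : Hv) (i : Fin 5) :
    moments f i = ∫ v, eFun i v * f v ∂maxwellian := by
  rw [moments, L2.inner_def]
  refine integral_congr_ae ?_
  filter_upwards [(memLp_eFun i).coeFn_toLp] with v hv
  have hc : (starRingEnd ℂ) (eFun i v) = eFun i v := by
    fin_cases i <;> simp [eFun_four]
  rw [e, hv, RCLike.inner_apply, hc, mul_comm]

/-- The macroscopic variables in `k`-aligned coordinates. -/
def alignedMoments (Q : Matrix (Fin 3) (Fin 3) ℝ) (f : Hv) : Fin 5 → ℂ :=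
  (Qtilde Q).transpose.mulVec (moments f)

theorem moments_eq_mulVec {Q : Matrix (Fin 3) (Fin 3) ℝ} (h : Q * Q.transpose = 1) (f : Hv) :
    moments f = (Qtilde Q).mulVec (alignedMoments Q f) := by
  rw [alignedMoments, Matrix.mulVec_mulVec, Qtilde_mul_transpose h, Matrix.one_mulVec]

theorem alignedMoments_zero (Q : Matrix (Fin 3) (Fin 3) ℝ) (f : Hv) :
    alignedMoments Q f 0 = moments f 0 := by
  simp [alignedMoments, Matrix.mulVec, dotProduct, Fin.sum_univ_five, Qtilde]

theorem integrable_eFun_mul (f : Hv) (i : Fin 5) :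
    Integrable (fun v => eFun i v * f v) maxwellian :=
  (memLp_eFun i).integrable_mul (Lp.memLp f)

theorem alignedMoments_eq_integral {Q : Matrix (Fin 3) (Fin 3) ℝ} (h : Q * Q.transpose = 1)
    (f : Hv) (i : Fin 5) :
    alignedMoments Q f i = ∫ v, eFun i (rotation h v) * f v ∂maxwellian := by
  have h1 : ∀ v, eFun i (rotation h v) * f v = ∑ l, Qtilde Q l i * (eFun l v * f v) := fun v => by
    rw [congrFun (eFun_rotation h v) i]
    simp only [Matrix.mulVec, dotProduct, Finset.sum_mul, Matrix.transpose_apply, mul_assoc]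
  simp_rw [h1]
  rw [integral_finsetSum _ fun l _ => (integrable_eFun_mul f l).const_mul _]
  simp only [integral_const_mul, ← moments_eq_integral]
  rfl

/-- Moments and collision invariants transform by the same orthogonal matrix, so `ℙ₅ f` has the same
form in the rotated frame. -/
theorem sum_moments_mul_eFun {Q : Matrix (Fin 3) (Fin 3) ℝ} (h : Q * Q.transpose = 1)
    (f : Hv) (v : R3) :
    ∑ j, moments f j * eFun j v = ∑ j, alignedMoments Q f j * eFun j (rotation h v) := by
  change moments f ⬝ᵥ (fun j => eFun j v) =
    alignedMoments Q f ⬝ᵥ (fun j => eFun j (rotation h v))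
  rw [eFun_rotation, alignedMoments, Matrix.dotProduct_mulVec, Matrix.vecMul_transpose,
    Matrix.mulVec_mulVec, Qtilde_mul_transpose h, Matrix.one_mulVec]

/-! ### The eigenvalue equation as a five-dimensional linear system. -/

theorem P5_ae (f : Hv) : P5 f =ᵐ[maxwellian] fun v => ∑ j, moments f j * eFun j v := by
  have h1 : P5 f =ᵐ[maxwellian] fun v => ∑ j, (moments f j • e j : Hv) v := by
    rw [P5]
    filter_upwards [Lp.coeFn_finsetSum Finset.univ fun j => moments f j • e j] with v hv
    rw [hv]
    simp
  have h2 : ∀ᵐ v ∂maxwellian, ∀ j, (moments f j • e j : Hv) v = moments f j * eFun j v := by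
    refine ae_all_iff.2 fun j => ?_
    filter_upwards [Lp.coeFn_smul (moments f j) (e j), (memLp_eFun j).coeFn_toLp] with v hv hv2
    rw [hv, Pi.smul_apply, e, hv2, smul_eq_mul]
  filter_upwards [h1, h2] with v hv hv2
  simp [hv, hv2]

theorem mem_eigenspace_iff {τ : ℝ} {k : R3} {lam : ℂ} {f : Hv} :
    f ∈ eigenspace τ k lam ↔ ∀ᵐ v ∂maxwellian,
      (lam + ((1 / τ : ℝ) : ℂ) + Complex.I * (inner ℝ v k : ℝ)) * f v =
        ((1 / τ : ℝ) : ℂ) * ∑ j, moments f j * eFun j v := by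
  have key : ∀ (hf : MemLp (transport k f) 2 maxwellian),
      ((-Complex.I) • (hf.toLp (transport k f) : Hv) - ((1 / τ : ℝ) : ℂ) • (f - P5 f) : Hv)
        =ᵐ[maxwellian] fun v => -Complex.I * transport k f v -
          ((1 / τ : ℝ) : ℂ) * (f v - ∑ j, moments f j * eFun j v) := fun hf => by
    filter_upwards [Lp.coeFn_sub ((-Complex.I) • (hf.toLp (transport k f) : Hv))
      (((1 / τ : ℝ) : ℂ) • (f - P5 f)), Lp.coeFn_smul (-Complex.I) (hf.toLp (transport k f) : Hv),
      hf.coeFn_toLp, Lp.coeFn_smul ((1 / τ : ℝ) : ℂ) (f - P5 f), Lp.coeFn_sub f (P5 f), P5_ae f]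
      with v h1 h2 h3 h4 h5 h6
    rw [h1, Pi.sub_apply, h2, h4, Pi.smul_apply, Pi.smul_apply, h3, h5, Pi.sub_apply, h6]
    rfl
  constructor
  · intro h
    obtain ⟨⟨g, hg⟩, hfg, hL⟩ := (LinearPMap.mem_graph_iff _).1 h
    obtain rfl : g = f := hfg
    have hL' : ((-Complex.I) • (MemLp.toLp (transport k g) hg : Hv)
        - ((1 / τ : ℝ) : ℂ) • (g - P5 g) : Hv) = lam • g := hL
    filter_upwards [key hg, Lp.coeFn_smul lam g] with v h1 h2
    rw [hL', h2] at h1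
    simp only [Pi.smul_apply, smul_eq_mul, transport] at h1
    linear_combination h1
  · intro h
    -- The domain condition is automatic: the equation expresses `(v · k) f` through `f` and `P5 f`,
    -- both square integrable.
    have hf : MemLp (transport k f) 2 maxwellian := by
      have h1 : MemLp (fun v => -Complex.I * (((1 / τ : ℝ) : ℂ) * P5 f v -
          (lam + ((1 / τ : ℝ) : ℂ)) * f v)) 2 maxwellian :=
        (((Lp.memLp (P5 f)).const_mul _).sub ((Lp.memLp f).const_mul _)).const_mul _
      refine (memLp_congr_ae ?_).1 h1
      filter_upwards [h, P5_ae f] with v hv h6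
      rw [h6, transport]
      linear_combination (Complex.I) * hv -
        (inner ℝ v k : ℝ) * f v * Complex.I_sq
    refine (LinearPMap.mem_graph_iff _).2 ⟨⟨f, hf⟩, rfl, ?_⟩
    change ((-Complex.I) • (hf.toLp (transport k f) : Hv) - ((1 / τ : ℝ) : ℂ) • (f - P5 f) : Hv) =
      lam • f
    refine Lp.ext ?_
    filter_upwards [key hf, Lp.coeFn_smul lam f, h] with v h1 h2 h3
    rw [h1, h2, Pi.smul_apply, smul_eq_mul, transport]
    linear_combination -h3

/-- The spectral variable `ζ = i (τ lam + 1) / (τ κ)`. -/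
def zetaOf (τ κ : ℝ) (lam : ℂ) : ℂ := Complex.I * (τ * lam + 1) / (τ * κ)

/-- The imaginary part is `(τ Re lam + 1)/(τκ)`; to the right of `-1/τ` the pole stays off the real
line and the resolvent kernel is bounded. -/
theorem zetaOf_im_pos {τ κ : ℝ} (hτ : 0 < τ) (hκ : 0 < κ) {lam : ℂ} (h : -(1 / τ) < lam.re) :
    0 < (zetaOf τ κ lam).im := by
  have h1 : zetaOf τ κ lam = Complex.I * (τ * lam + 1) / ((τ * κ : ℝ) : ℂ) := by
    simp [zetaOf]
  have h2 : 0 < τ * lam.re + 1 := by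
    have := mul_lt_mul_of_pos_left h hτ
    field_simp at this
    linarith
  rw [h1, Complex.div_ofReal_im]
  simp only [Complex.mul_im, Complex.I_re, Complex.I_im, Complex.add_re, Complex.mul_re,
    Complex.ofReal_re, Complex.ofReal_im, Complex.one_re]
  have : 0 < τ * κ := by positivity
  simpa using div_pos h2 this

theorem memLp_eFun_mul_inv {ζ : ℂ} (hζ : 0 < ζ.im) (j : Fin 5) :
    MemLp (fun v : R3 => eFun j v * (((v 0 : ℝ) : ℂ) - ζ)⁻¹) 2 maxwellian := by
  refine (memLp_eFun j).of_le_mul (c := ζ.im⁻¹) ?_ (Filter.Eventually.of_forall fun v => ?_)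
  · exact ((continuous_eFun j).measurable.mul (by fun_prop)).aestronglyMeasurable
  · rw [norm_mul, mul_comm]
    exact mul_le_mul_of_nonneg_right (norm_inv_sub_le hζ (v 0)) (norm_nonneg _)

section spectral

variable {τ : ℝ} (hτ : 0 < τ) {k : R3} (hk : 0 < ‖k‖) {Q : Matrix (Fin 3) (Fin 3) ℝ}
  (hQ : IsAligning k Q) {lam : ℂ} (hlam : -(1 / τ) < lam.re)
include hτ hk hQ hlam

theorem mem_eigenspace_iff_aligned {f : Hv} :
    f ∈ eigenspace τ k lam ↔ ∀ᵐ v ∂maxwellian,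
      f v = (Complex.I * (‖k‖ * τ))⁻¹ * ∑ j, alignedMoments Q f j *
        (eFun j (rotation hQ.mul_transpose v) *
          (((rotation hQ.mul_transpose v 0 : ℝ) : ℂ) - zetaOf τ ‖k‖ lam)⁻¹) := by
  rw [mem_eigenspace_iff]
  refine Filter.eventually_congr (Filter.Eventually.of_forall fun v => ?_)
  rw [sum_moments_mul_eFun hQ.mul_transpose, inner_eq_rotation hQ]
  have hne := sub_ne_zero_of_im_pos (zetaOf_im_pos hτ hk hlam) (rotation hQ.mul_transpose v 0)
  simp only [← mul_assoc, ← Finset.sum_mul]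
  set w : ℝ := rotation hQ.mul_transpose v 0
  have hτ' : (τ : ℂ) ≠ 0 := by exact_mod_cast hτ.ne'
  have hk' : (‖k‖ : ℂ) ≠ 0 := by exact_mod_cast hk.ne'
  have h1 : lam + ((1 / τ : ℝ) : ℂ) + Complex.I * ((‖k‖ * w : ℝ) : ℂ) =
      Complex.I * ‖k‖ * ((w : ℂ) - zetaOf τ ‖k‖ lam) := by
    rw [zetaOf]
    push_cast
    field_simp
    linear_combination (τ * lam + 1) * Complex.I_sq
  rw [h1, eq_mul_inv_iff_mul_eq₀ hne, mul_inv, mul_inv, Complex.inv_I]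
  push_cast
  generalize (∑ j, alignedMoments Q f j * eFun j (rotation hQ.mul_transpose v)) = S
  generalize (w : ℂ) - zetaOf τ ‖k‖ lam = d
  constructor
  · intro h
    field_simp at h ⊢
    linear_combination -Complex.I * h + (f v * d * ‖k‖ * τ) * Complex.I_sq
  · intro h
    field_simp at h ⊢
    linear_combination Complex.I * h - S * Complex.I_sq

theorem eigenspace_ext {f g : Hv} (hf : f ∈ eigenspace τ k lam) (hg : g ∈ eigenspace τ k lam)
    (h : alignedMoments Q f = alignedMoments Q g) : f = g := by
  rw [mem_eigenspace_iff_aligned hτ hk hQ hlam] at hf hg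
  refine Lp.ext ?_
  filter_upwards [hf, hg] with v h1 h2
  rw [h1, h2, h]

/-- Rotation invariance of the Maxwellian removes the rotation from the integrand, leaving Gram
entries. -/
theorem integral_resolvent (c : Fin 5 → ℂ) (i : Fin 5) :
    ∫ v, eFun i (rotation hQ.mul_transpose v) * ((Complex.I * (‖k‖ * τ))⁻¹ * ∑ j, c j *
        (eFun j (rotation hQ.mul_transpose v) *
          (((rotation hQ.mul_transpose v 0 : ℝ) : ℂ) - zetaOf τ ‖k‖ lam)⁻¹)) ∂maxwellian =
      (Complex.I * (‖k‖ * τ))⁻¹ * ∑ j, gram (zetaOf τ ‖k‖ lam) i j * c j := by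
  have hmp := measurePreserving_maxwellian (rotation hQ.mul_transpose)
  refine (hmp.integral_comp (rotation hQ.mul_transpose).toHomeomorph.measurableEmbedding
    fun v => eFun i v * ((Complex.I * (‖k‖ * τ))⁻¹ * ∑ j, c j *
        (eFun j v * (((v 0 : ℝ) : ℂ) - zetaOf τ ‖k‖ lam)⁻¹))).trans ?_
  have h1 : ∀ v : R3, eFun i v * ((Complex.I * (‖k‖ * τ))⁻¹ * ∑ j, c j *
        (eFun j v * (((v 0 : ℝ) : ℂ) - zetaOf τ ‖k‖ lam)⁻¹)) =
      (Complex.I * (‖k‖ * τ))⁻¹ * ∑ j, c j *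
        (eFun i v * eFun j v * (((v 0 : ℝ) : ℂ) - zetaOf τ ‖k‖ lam)⁻¹) := fun v => by
    rw [mul_left_comm, Finset.mul_sum]
    congr 1
    refine Finset.sum_congr rfl fun j _ => ?_
    ring
  simp_rw [h1]
  rw [integral_const_mul, integral_finsetSum _ fun j _ =>
    (integrable_eFun_mul_eFun_mul (zetaOf_im_pos hτ hk hlam) i j).const_mul _]
  congr 1
  refine Finset.sum_congr rfl fun j _ => ?_
  rw [integral_const_mul, mul_comm, gram]

theorem alignedMoments_eq_gram {f : Hv} (hf : f ∈ eigenspace τ k lam) (i : Fin 5) :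
    Complex.I * (‖k‖ * τ) * alignedMoments Q f i =
      ∑ j, gram (zetaOf τ ‖k‖ lam) i j * alignedMoments Q f j := by
  rw [mem_eigenspace_iff_aligned hτ hk hQ hlam] at hf
  have h1 : alignedMoments Q f i = (Complex.I * (‖k‖ * τ))⁻¹ *
      ∑ j, gram (zetaOf τ ‖k‖ lam) i j * alignedMoments Q f j := by
    rw [← integral_resolvent hτ hk hQ hlam, alignedMoments_eq_integral hQ.mul_transpose]
    refine integral_congr_ae ?_
    filter_upwards [hf] with v hv
    rw [← hv]
  have hτ' : (τ : ℂ) ≠ 0 := by exact_mod_cast hτ.ne'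
  have hk' : (‖k‖ : ℂ) ≠ 0 := by exact_mod_cast hk.ne'
  rwa [eq_inv_mul_iff_mul_eq₀ (by simp [hτ', hk'])] at h1

/-- The resolvent formula with coefficients `c` defines a function in `L²`; the linear system says
exactly that its moments are `c` again, so it is an eigenvector. -/
theorem exists_mem_eigenspace {c : Fin 5 → ℂ}
    (hc : ∀ i, Complex.I * (‖k‖ * τ) * c i = ∑ j, gram (zetaOf τ ‖k‖ lam) i j * c j) :
    ∃ f ∈ eigenspace τ k lam, alignedMoments Q f = c := by
  have hτ' : (τ : ℂ) ≠ 0 := by exact_mod_cast hτ.ne'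
  have hk' : (‖k‖ : ℂ) ≠ 0 := by exact_mod_cast hk.ne'
  have hζ := zetaOf_im_pos hτ hk hlam
  have hmp := measurePreserving_maxwellian (rotation hQ.mul_transpose)
  have hmem : MemLp (fun v : R3 => (Complex.I * (‖k‖ * τ))⁻¹ * ∑ j, c j *
        (eFun j (rotation hQ.mul_transpose v) *
          (((rotation hQ.mul_transpose v 0 : ℝ) : ℂ) - zetaOf τ ‖k‖ lam)⁻¹)) 2 maxwellian := by
    have h1 := fun j => ((memLp_eFun_mul_inv hζ j).comp_measurePreserving hmp).const_mul (c j)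
    have h2 := memLp_finsetSum Finset.univ fun j _ => h1 j
    exact h2.const_mul _
  have hmom : alignedMoments Q (hmem.toLp _) = c := by
    ext i
    rw [alignedMoments_eq_integral hQ.mul_transpose]
    have : ∫ v, eFun i (rotation hQ.mul_transpose v) * (hmem.toLp _ : Hv) v ∂maxwellian =
        (Complex.I * (‖k‖ * τ))⁻¹ * ∑ j, gram (zetaOf τ ‖k‖ lam) i j * c j := by
      rw [← integral_resolvent hτ hk hQ hlam]
      refine integral_congr_ae ?_
      filter_upwards [hmem.coeFn_toLp] with v hv
      rw [hv]
    rw [this, ← hc, inv_mul_cancel_left₀ (by simp [hτ', hk'])]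
  refine ⟨hmem.toLp _, ?_, hmom⟩
  rw [mem_eigenspace_iff_aligned hτ hk hQ hlam, hmom]
  exact hmem.coeFn_toLp

end spectral

theorem moments_add (f g : Hv) : moments (f + g) = moments f + moments g := by
  ext j
  simp [moments, inner_add_right]

theorem moments_smul (c : ℂ) (f : Hv) : moments (c • f) = c • moments f := by
  ext j
  simp [moments, inner_smul_right]

theorem alignedMoments_add (Q : Matrix (Fin 3) (Fin 3) ℝ) (f g : Hv) :
    alignedMoments Q (f + g) = alignedMoments Q f + alignedMoments Q g := by
  rw [alignedMoments, moments_add, Matrix.mulVec_add]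
  rfl

theorem alignedMoments_smul (Q : Matrix (Fin 3) (Fin 3) ℝ) (c : ℂ) (f : Hv) :
    alignedMoments Q (c • f) = c • alignedMoments Q f := by
  rw [alignedMoments, moments_smul, Matrix.mulVec_smul]
  rfl

/-- The macroscopic variables of the normalized eigenvector to a simple mode, in `k`-aligned
coordinates. -/
def simpleVector (τ κ : ℝ) (lam : ℂ) : Fin 5 → ℂ :=
  ![1, Complex.I * lam / κ, 0, 0, spectralTemp τ κ lam]

/-! ### Shape of the eigenvectors and the dichotomy between simple and shear modes. -/

section spectral

variable {τ : ℝ} (hτ : 0 < τ) {k : R3} (hk : 0 < ‖k‖) {Q : Matrix (Fin 3) (Fin 3) ℝ}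
  (hQ : IsAligning k Q) {lam : ℂ} (hlam : -(1 / τ) < lam.re)
include hτ hk hQ hlam

theorem row_zero {f : Hv} (hf : f ∈ eigenspace τ k lam) :
    Complex.I * (‖k‖ * τ) * alignedMoments Q f 0 =
      plasmaZ (zetaOf τ ‖k‖ lam) * alignedMoments Q f 0 +
      (1 + zetaOf τ ‖k‖ lam * plasmaZ (zetaOf τ ‖k‖ lam)) * alignedMoments Q f 1 +
      (zetaOf τ ‖k‖ lam + (zetaOf τ ‖k‖ lam ^ 2 - 1) * plasmaZ (zetaOf τ ‖k‖ lam)) / (√6 : ℝ) *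
        alignedMoments Q f 4 := by
  have hζ := zetaOf_im_pos hτ hk hlam
  have h := alignedMoments_eq_gram hτ hk hQ hlam hf 0
  rw [Fin.sum_univ_five, gram_zero_zero, gram_zero_one hζ, gram_zero_two hζ, gram_zero_three hζ,
    gram_zero_four hζ] at h
  linear_combination h

theorem mass_balance {f : Hv} (hf : f ∈ eigenspace τ k lam) :
    alignedMoments Q f 1 = Complex.I * lam / ‖k‖ * alignedMoments Q f 0 := by
  have hζ := zetaOf_im_pos hτ hk hlam
  have h0 := alignedMoments_eq_gram hτ hk hQ hlam hf 0
  have h1 := alignedMoments_eq_gram hτ hk hQ hlam hf 1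
  -- Row 1 minus `ζ` times row 0.
  have h2 : Complex.I * (‖k‖ * τ) * alignedMoments Q f 1 = alignedMoments Q f 0 +
      zetaOf τ ‖k‖ lam * (Complex.I * (‖k‖ * τ) * alignedMoments Q f 0) := by
    rw [h0, h1]
    simp only [gram_one hζ, add_mul, Finset.sum_add_distrib, ite_mul, one_mul, zero_mul,
      Finset.sum_ite_eq', Finset.mem_univ, if_true, Finset.mul_sum, mul_assoc]
  have hτ' : (τ : ℂ) ≠ 0 := by exact_mod_cast hτ.ne'
  have hk' : (‖k‖ : ℂ) ≠ 0 := by exact_mod_cast hk.ne'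
  rw [zetaOf] at h2
  field_simp at h2 ⊢
  refine mul_left_cancel₀ hτ' (mul_left_cancel₀ Complex.I_ne_zero ?_)
  linear_combination h2 + alignedMoments Q f 0 * Complex.I_sq

theorem row_two {f : Hv} (hf : f ∈ eigenspace τ k lam) :
    Complex.I * (‖k‖ * τ) * alignedMoments Q f 2 =
      plasmaZ (zetaOf τ ‖k‖ lam) * alignedMoments Q f 2 := by
  have hζ := zetaOf_im_pos hτ hk hlam
  have h := alignedMoments_eq_gram hτ hk hQ hlam hf 2
  rw [Fin.sum_univ_five, gram_comm _ 2 0, gram_zero_two hζ, gram_comm _ 2 1, gram_one hζ,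
    gram_zero_two hζ, gram_two_two hζ, gram_two_three hζ, gram_two_four hζ] at h
  simpa using h

theorem row_three {f : Hv} (hf : f ∈ eigenspace τ k lam) :
    Complex.I * (‖k‖ * τ) * alignedMoments Q f 3 =
      plasmaZ (zetaOf τ ‖k‖ lam) * alignedMoments Q f 3 := by
  have hζ := zetaOf_im_pos hτ hk hlam
  have h := alignedMoments_eq_gram hτ hk hQ hlam hf 3
  rw [Fin.sum_univ_five, gram_comm _ 3 0, gram_zero_three hζ, gram_comm _ 3 1, gram_one hζ,
    gram_zero_three hζ, gram_comm _ 3 2, gram_two_three hζ, gram_three_three hζ,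
    gram_three_four hζ] at h
  simpa using h

/-- When the denominator vanishes, the energy row collapses to `6i‖k‖τ c₄ = m Z c₄` with `m` real.
If `c₄ ≠ 0`, then `Z` is purely imaginary, hence so is `ζ`, and there the denominator cannot vanish.
-/
theorem alignedMoments_four_eq_zero {f : Hv} (hf : f ∈ eigenspace τ k lam)
    (hA : zetaOf τ ‖k‖ lam + (zetaOf τ ‖k‖ lam ^ 2 - 1) * plasmaZ (zetaOf τ ‖k‖ lam) = 0) :
    alignedMoments Q f 4 = 0 := by
  have hζ := zetaOf_im_pos hτ hk hlam
  have h := alignedMoments_eq_gram hτ hk hQ hlam hf 4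
  obtain ⟨m, hm⟩ := exists_gram_four_four hζ
  rw [Fin.sum_univ_five, gram_comm _ 4 0, gram_comm _ 4 1, gram_one hζ, gram_zero_four hζ,
    gram_comm _ 4 2, gram_two_four hζ, gram_comm _ 4 3, gram_three_four hζ, hm, hA] at h
  by_contra h4
  have h5 : ((‖k‖ * τ * 6 : ℝ) : ℂ) * Complex.I = (m : ℂ) * plasmaZ (zetaOf τ ‖k‖ lam) := by
    refine mul_right_cancel₀ h4 ?_
    push_cast
    simp only [zero_div, mul_zero, zero_mul, zero_add, add_zero,
      if_neg (show (4 : Fin 5) ≠ 0 by decide)] at h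
    linear_combination 6 * h
  have hre := congrArg Complex.re h5
  have him := congrArg Complex.im h5
  simp only [Complex.re_ofReal_mul, Complex.im_ofReal_mul, Complex.I_re, Complex.I_im, mul_zero,
    mul_one] at hre him
  have hm0 : m ≠ 0 := fun h0 => by
    rw [h0, zero_mul] at him
    exact absurd him (by positivity)
  have hZ := (mul_eq_zero.1 hre.symm).resolve_left hm0
  exact add_sq_sub_one_mul_plasmaZ_ne_zero hζ (re_eq_zero_of_re_plasmaZ_eq_zero hζ hZ) hA

theorem alignedMoments_four_of_zero {f : Hv} (hf : f ∈ eigenspace τ k lam)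
    (h0 : alignedMoments Q f 0 = 0) : alignedMoments Q f 4 = 0 := by
  have h1 := mass_balance hτ hk hQ hlam hf
  have h := row_zero hτ hk hQ hlam hf
  rw [h1, h0] at h
  by_contra h4
  refine h4 (alignedMoments_four_eq_zero hτ hk hQ hlam hf ?_)
  have := sqrt_six_ne_zero
  simpa [h4, this] using h.symm

/-- The denominator of the spectral temperature does not vanish at an eigenvalue with an eigenvector
of non-zero density. -/
theorem denominator_ne_zero (hlam0 : lam.re < 0) {f : Hv} (hf : f ∈ eigenspace τ k lam)
    (h0 : alignedMoments Q f 0 ≠ 0) :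
    zetaOf τ ‖k‖ lam + (zetaOf τ ‖k‖ lam ^ 2 - 1) * plasmaZ (zetaOf τ ‖k‖ lam) ≠ 0 := by
  intro hA
  have h1 := mass_balance hτ hk hQ hlam hf
  have h := row_zero hτ hk hQ hlam hf
  rw [h1, alignedMoments_four_eq_zero hτ hk hQ hlam hf hA] at h
  have hτ' : (τ : ℂ) ≠ 0 := by exact_mod_cast hτ.ne'
  have hk' : (‖k‖ : ℂ) ≠ 0 := by exact_mod_cast hk.ne'
  have h2 : Complex.I * (‖k‖ * τ) = plasmaZ (zetaOf τ ‖k‖ lam) +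
      (1 + zetaOf τ ‖k‖ lam * plasmaZ (zetaOf τ ‖k‖ lam)) * (Complex.I * lam / ‖k‖) := by
    refine mul_right_cancel₀ h0 ?_
    linear_combination h
  have h3 : zetaOf τ ‖k‖ lam = Complex.I * lam / ‖k‖ + Complex.I / (‖k‖ * τ) := by
    rw [zetaOf]
    field_simp
  generalize plasmaZ (zetaOf τ ‖k‖ lam) = Z at hA h2
  generalize zetaOf τ ‖k‖ lam = ζ at hA h2 h3
  -- Eliminate `Z` between the density row and the vanishing denominator. Inserting `ζ` then leaves
  -- `lam² = -‖k‖²`, so `lam` would be purely imaginary.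
  have h4 : Complex.I * (‖k‖ * τ) * (ζ ^ 2 - 1) = -ζ - Complex.I * lam / ‖k‖ := by
    linear_combination (ζ ^ 2 - 1) * h2 + (1 + ζ * (Complex.I * lam / ‖k‖)) * hA
  have h5 : lam ^ 2 = -(‖k‖ : ℂ) ^ 2 := by
    rw [h3] at h4
    field_simp at h4
    ring_nf at h4
    simp only [Complex.I_sq] at h4
    refine mul_left_cancel₀ (pow_ne_zero 2 hτ') ?_
    linear_combination -h4
  have hre := congrArg Complex.re h5
  have him := congrArg Complex.im h5
  rw [← Complex.ofReal_pow, ← Complex.ofReal_neg, Complex.ofReal_re, sq, Complex.mul_re] at hre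
  rw [← Complex.ofReal_pow, ← Complex.ofReal_neg, Complex.ofReal_im, sq, Complex.mul_im] at him
  have him0 : lam.im = 0 := by
    have : lam.re * lam.im = 0 := by linarith
    exact (mul_eq_zero.1 this).resolve_left hlam0.ne
  rw [him0] at hre
  nlinarith [sq_nonneg lam.re, pow_pos hk 2]

theorem alignedMoments_four (hlam0 : lam.re < 0) {f : Hv} (hf : f ∈ eigenspace τ k lam) :
    alignedMoments Q f 4 = alignedMoments Q f 0 * spectralTemp τ ‖k‖ lam := by
  by_cases h0 : alignedMoments Q f 0 = 0
  · rw [h0, zero_mul, alignedMoments_four_of_zero hτ hk hQ hlam hf h0]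
  have hA := denominator_ne_zero hτ hk hQ hlam hlam0 hf h0
  have h1 := mass_balance hτ hk hQ hlam hf
  have h := row_zero hτ hk hQ hlam hf
  rw [h1] at h
  have hτ' : (τ : ℂ) ≠ 0 := by exact_mod_cast hτ.ne'
  have hk' : (‖k‖ : ℂ) ≠ 0 := by exact_mod_cast hk.ne'
  have h3 : Complex.I * lam / ‖k‖ = zetaOf τ ‖k‖ lam - Complex.I / (‖k‖ * τ) := by
    rw [zetaOf]
    field_simp
    ring
  have hθ : spectralTemp τ ‖k‖ lam = Complex.I * (√6 : ℝ) *
      ((‖k‖ : ℂ) ^ 2 * (τ : ℂ) ^ 2 + Complex.I * zetaOf τ ‖k‖ lam * ‖k‖ * τ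
        + plasmaZ (zetaOf τ ‖k‖ lam) * (zetaOf τ ‖k‖ lam +
          Complex.I * (zetaOf τ ‖k‖ lam ^ 2 + 1) * ‖k‖ * τ) + 1) /
      (‖k‖ * τ * (zetaOf τ ‖k‖ lam +
        (zetaOf τ ‖k‖ lam ^ 2 - 1) * plasmaZ (zetaOf τ ‖k‖ lam))) := rfl
  rw [hθ]
  rw [h3] at h
  have h6 := sqrt_six_ne_zero
  generalize plasmaZ (zetaOf τ ‖k‖ lam) = Z at hA h
  generalize zetaOf τ ‖k‖ lam = ζ at hA h
  rw [mul_div_assoc', eq_div_iff (mul_ne_zero (mul_ne_zero hk' hτ') hA)]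
  have hq : Complex.I / (‖k‖ * τ) * (‖k‖ * τ) = Complex.I :=
    div_mul_cancel₀ _ (mul_ne_zero hk' hτ')
  have hr : (ζ + (ζ ^ 2 - 1) * Z) / (√6 : ℝ) * (√6 : ℝ) = ζ + (ζ ^ 2 - 1) * Z :=
    div_mul_cancel₀ _ h6
  generalize Complex.I / (‖k‖ * τ) = q at h hq
  generalize (ζ + (ζ ^ 2 - 1) * Z) / (√6 : ℝ) = r at h hr
  linear_combination -(‖k‖ * τ * (√6 : ℝ)) * h + (1 + ζ * Z) * alignedMoments Q f 0 * (√6 : ℝ) * hq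
    - alignedMoments Q f 4 * (‖k‖ * τ) * hr
    - alignedMoments Q f 0 * (√6 : ℝ) * (‖k‖ * τ) * (ζ + Z * (ζ ^ 2 + 1)) * Complex.I_sq

/-- A transverse unit vector is an eigenvector of the Gram matrix with eigenvalue `Z`, so it solves
the linear system exactly when `Z = i‖k‖τ`. -/
theorem exists_shear {i : Fin 5} (hi : i = 2 ∨ i = 3)
    (hZ : plasmaZ (zetaOf τ ‖k‖ lam) = Complex.I * (‖k‖ * τ)) :
    ∃ f ∈ eigenspace τ k lam, alignedMoments Q f = Pi.single i 1 := by
  have hζ := zetaOf_im_pos hτ hk hlam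
  refine exists_mem_eigenspace hτ hk hQ hlam fun l => ?_
  simp only [Pi.single_apply, mul_ite, mul_one, mul_zero, Finset.sum_ite_eq', Finset.mem_univ,
    if_true]
  rcases hi with rfl | rfl
  · fin_cases l
    · simp [gram_zero_two hζ]
    · simp [gram_one hζ, gram_zero_two hζ]
    · simp [gram_two_two hζ, hZ]
    · simp [gram_comm _ 3 2, gram_two_three hζ]
    · simp [gram_comm _ 4 2, gram_two_four hζ]
  · fin_cases l
    · simp [gram_zero_three hζ]
    · simp [gram_one hζ, gram_zero_three hζ]
    · simp [gram_two_three hζ]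
    · simp [gram_three_three hζ, hZ]
    · simp [gram_comm _ 4 3, gram_three_four hζ]

theorem shear_components_eq_zero (hZ : plasmaZ (zetaOf τ ‖k‖ lam) ≠ Complex.I * (‖k‖ * τ))
    {f : Hv} (hf : f ∈ eigenspace τ k lam) :
    alignedMoments Q f 2 = 0 ∧ alignedMoments Q f 3 = 0 := by
  have h2 := row_two hτ hk hQ hlam hf
  have h3 := row_three hτ hk hQ hlam hf
  constructor
  · by_contra h
    exact hZ (mul_right_cancel₀ h h2).symm
  · by_contra h
    exact hZ (mul_right_cancel₀ h h3).symm

theorem eq_smul_simpleVector (hlam0 : lam.re < 0)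
    (hZ : plasmaZ (zetaOf τ ‖k‖ lam) ≠ Complex.I * (‖k‖ * τ))
    {f : Hv} (hf : f ∈ eigenspace τ k lam) :
    alignedMoments Q f = alignedMoments Q f 0 • simpleVector τ ‖k‖ lam := by
  obtain ⟨h2, h3⟩ := shear_components_eq_zero hτ hk hQ hlam hZ hf
  have h1 := mass_balance hτ hk hQ hlam hf
  have h4 := alignedMoments_four hτ hk hQ hlam hlam0 hf
  ext i
  fin_cases i
  · simp [simpleVector]
  · simpa [simpleVector, mul_comm] using h1
  · simpa [simpleVector] using h2
  · simpa [simpleVector] using h3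
  · simpa [simpleVector] using h4

/-- Equality would provide two independent shear eigenvectors. -/
theorem plasmaZ_ne_of_simple (h1 : Module.finrank ℂ (eigenspace τ k lam) = 1) :
    plasmaZ (zetaOf τ ‖k‖ lam) ≠ Complex.I * (‖k‖ * τ) := by
  intro hZ
  obtain ⟨f, hf, hf2⟩ := exists_shear hτ hk hQ hlam (Or.inl rfl) hZ
  obtain ⟨g, hg, hg3⟩ := exists_shear hτ hk hQ hlam (Or.inr rfl) hZ
  have hf0 : (⟨f, hf⟩ : eigenspace τ k lam) ≠ 0 := fun h => by
    have hf0 : f = (0 : ℂ) • f := by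
      rw [zero_smul]
      exact congrArg Subtype.val h
    have := congrFun hf2 2
    rw [hf0, alignedMoments_smul] at this
    simp at this
  obtain ⟨c, hc⟩ := (finrank_eq_one_iff_of_nonzero' _ hf0).1 h1 ⟨g, hg⟩
  have hc' : c • f = g := congrArg Subtype.val hc
  have := congrFun hg3 3
  rw [← hc', alignedMoments_smul, hf2] at this
  simp at this

/-- Otherwise the density determines an eigenvector, so the eigenspace embeds in `ℂ`. -/
theorem plasmaZ_eq_of_shear (hlam0 : lam.re < 0)
    (h2 : Module.finrank ℂ (eigenspace τ k lam) = 2) :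
    plasmaZ (zetaOf τ ‖k‖ lam) = Complex.I * (‖k‖ * τ) := by
  by_contra hZ
  let T : eigenspace τ k lam →ₗ[ℂ] ℂ :=
    { toFun := fun f => alignedMoments Q f 0
      map_add' := fun f g => by simp [alignedMoments_add]
      map_smul' := fun c f => by simp [alignedMoments_smul] }
  have hT : Function.Injective T := fun f g hfg => by
    refine Subtype.ext (eigenspace_ext hτ hk hQ hlam f.2 g.2 ?_)
    rw [eq_smul_simpleVector hτ hk hQ hlam hlam0 hZ f.2,
      eq_smul_simpleVector hτ hk hQ hlam hlam0 hZ g.2]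
    congr 1
  have := LinearMap.finrank_le_finrank_of_injective hT
  rw [h2, Module.finrank_self] at this
  omega

/-- The two transverse moments map the eigenspace onto `ℂ²`; equality of dimensions makes this map
injective, so no eigenvector with density or temperature can share the shear eigenvalue. -/
theorem alignedMoments_of_shear (hlam0 : lam.re < 0)
    (h2 : Module.finrank ℂ (eigenspace τ k lam) = 2) {f : Hv} (hf : f ∈ eigenspace τ k lam) :
    alignedMoments Q f =
      alignedMoments Q f 2 • Pi.single 2 1 + alignedMoments Q f 3 • Pi.single 3 1 := by
  have hZ := plasmaZ_eq_of_shear hτ hk hQ hlam hlam0 h2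
  obtain ⟨g₂, hg₂, hm₂⟩ := exists_shear hτ hk hQ hlam (Or.inl rfl) hZ
  obtain ⟨g₃, hg₃, hm₃⟩ := exists_shear hτ hk hQ hlam (Or.inr rfl) hZ
  let T : eigenspace τ k lam →ₗ[ℂ] ℂ × ℂ :=
    { toFun := fun f => (alignedMoments Q f 2, alignedMoments Q f 3)
      map_add' := fun f g => by simp [alignedMoments_add]
      map_smul' := fun c f => by simp [alignedMoments_smul] }
  have hcomb : ∀ a b : ℂ, alignedMoments Q (a • g₂ + b • g₃) =
      a • Pi.single 2 1 + b • Pi.single 3 1 := fun a b => by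
    rw [alignedMoments_add, alignedMoments_smul, alignedMoments_smul, hm₂, hm₃]
  have hmem : ∀ a b : ℂ, a • g₂ + b • g₃ ∈ eigenspace τ k lam := fun a b =>
    add_mem (Submodule.smul_mem _ _ hg₂) (Submodule.smul_mem _ _ hg₃)
  have hTv : ∀ a b : ℂ, T ⟨_, hmem a b⟩ = (a, b) := fun a b => by
    simp [T, hcomb]
  have hsurj : Function.Surjective T := fun p => ⟨_, hTv p.1 p.2⟩
  have : FiniteDimensional ℂ (eigenspace τ k lam) :=
    Module.finite_of_finrank_pos (by rw [h2]; norm_num)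
  have hinj : Function.Injective T :=
    (LinearMap.injective_iff_surjective_of_finrank_eq_finrank (by simp [h2])).2 hsurj
  have heq : (⟨f, hf⟩ : eigenspace τ k lam) =
      ⟨_, hmem (alignedMoments Q f 2) (alignedMoments Q f 3)⟩ := hinj (by rw [hTv]; rfl)
  have heq' := congrArg (fun g : eigenspace τ k lam => alignedMoments Q (g : Hv)) heq
  exact heq'.trans (hcomb _ _)

theorem exists_normalized (hlam0 : lam.re < 0)
    (h1 : Module.finrank ℂ (eigenspace τ k lam) = 1) :
    ∃ f ∈ eigenspace τ k lam, moments f 0 = 1 := by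
  have hZ := plasmaZ_ne_of_simple hτ hk hQ hlam h1
  obtain ⟨⟨f, hf⟩, hf0, -⟩ := finrank_eq_one_iff'.1 h1
  -- With zero density all five moments vanish, and the moments determine the eigenvector.
  have h0 : alignedMoments Q f 0 ≠ 0 := fun h => hf0 <| Subtype.ext <| by
    refine eigenspace_ext hτ hk hQ hlam hf (Submodule.zero_mem _) ?_
    rw [eq_smul_simpleVector hτ hk hQ hlam hlam0 hZ hf, h, zero_smul]
    have := alignedMoments_smul Q 0 0
    rw [zero_smul, zero_smul] at this
    exact this.symm
  rw [alignedMoments_zero] at h0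
  exact ⟨(moments f 0)⁻¹ • f, Submodule.smul_mem _ _ hf, by simp [moments_smul, h0]⟩

end spectral

/-! ### Conjugation symmetry and the algebra of the transport coefficients. -/

theorem zetaOf_star (τ κ : ℝ) (lam : ℂ) : zetaOf τ κ (star lam) = -star (zetaOf τ κ lam) := by
  simp [zetaOf]
  ring

theorem spectralTemp_star (τ κ : ℝ) (lam : ℂ) :
    spectralTemp τ κ (star lam) = star (spectralTemp τ κ lam) := by
  have hθ : ∀ l, spectralTemp τ κ l = Complex.I * (√6 : ℝ) *
      ((κ : ℂ) ^ 2 * (τ : ℂ) ^ 2 + Complex.I * zetaOf τ κ l * κ * τ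
        + plasmaZ (zetaOf τ κ l) * (zetaOf τ κ l +
          Complex.I * (zetaOf τ κ l ^ 2 + 1) * κ * τ) + 1) /
      (κ * τ * (zetaOf τ κ l + (zetaOf τ κ l ^ 2 - 1) * plasmaZ (zetaOf τ κ l))) := fun _ => rfl
  rw [hθ, hθ, zetaOf_star, plasmaZ_neg_conj]
  generalize plasmaZ (zetaOf τ κ lam) = Z
  generalize zetaOf τ κ lam = ζ
  simp only [Complex.star_def, map_div₀, map_mul, map_add, map_sub, map_pow, map_one,
    Complex.conj_ofReal, Complex.conj_I]
  rw [show (κ : ℂ) * τ * (-(starRingEnd ℂ) ζ + ((-(starRingEnd ℂ) ζ) ^ 2 - 1) *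
    -(starRingEnd ℂ) Z) = -(κ * τ * ((starRingEnd ℂ) ζ + ((starRingEnd ℂ) ζ ^ 2 - 1) *
      (starRingEnd ℂ) Z)) by ring, div_neg, ← neg_div]
  congr 1
  ring

/-- The spectral basis matrix in `k`-aligned coordinates, for the vector `x` of simple eigenvalues
and the vector `t` of their spectral temperatures. -/
def alignedMatrix (κ : ℝ) (x t : Fin 3 → ℂ) : Matrix (Fin 5) (Fin 5) ℂ :=
  !![1, 1, 1, 0, 0;
     Complex.I * x 0 / κ, Complex.I * x 1 / κ, Complex.I * x 2 / κ, 0, 0;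
     0, 0, 0, 1, 0;
     0, 0, 0, 0, 1;
     t 0, t 1, t 2, 0, 0]

theorem det_alignedMatrix (κ : ℝ) (x t : Fin 3 → ℂ) :
    (alignedMatrix κ x t).det = Complex.I / κ *
      (t 0 * (x 2 - x 1) + t 1 * (x 0 - x 2) + t 2 * (x 1 - x 0)) := by
  simp [alignedMatrix, Matrix.det_succ_row_zero, Fin.sum_univ_succ, Fin.succAbove]
  ring

/-- Cramer's rule for the momentum row, read at each of the three simple modes. -/
theorem transportC_momentum {κ : ℝ} (x : Fin 3 → ℂ) (θ : ℂ → ℂ) {D : ℂ} (hD0 : D ≠ 0)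
    (hD : D = Complex.I / κ *
      (θ (x 0) * (x 2 - x 1) + θ (x 1) * (x 0 - x 2) + θ (x 2) * (x 1 - x 0))) (l : Fin 3) :
    transportC κ x θ D 0 + transportC κ x θ D 1 * (Complex.I * x l / κ) +
      transportC κ x θ D 2 * θ (x l) = Complex.I * x l / κ * x l := by
  have hDD : D * D⁻¹ = 1 := mul_inv_cancel₀ hD0
  obtain ⟨Δ, hΔ⟩ : ∃ Δ, Δ = θ (x 0) * (x 2 - x 1) + θ (x 1) * (x 0 - x 2) +
    θ (x 2) * (x 1 - x 0) := ⟨_, rfl⟩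
  obtain ⟨S₁, hS₁⟩ : ∃ S, S = cyclicSum x fun a b c => a * c * (a - c) * θ b := ⟨_, rfl⟩
  obtain ⟨S₂, hS₂⟩ : ∃ S, S = cyclicSum x fun a b c => (a ^ 2 - c ^ 2) * θ b := ⟨_, rfl⟩
  obtain ⟨P, hP⟩ : ∃ P, P = cyclicProd x fun a b _ => a - b := ⟨_, rfl⟩
  -- Up to sign, expansion of a 4×4 determinant with rows `(1, x, θ, x²)` at the three nodes and at
  -- `x l` once more; it vanishes because a row is repeated.
  have key : S₁ - S₂ * x l - P * θ (x l) + Δ * x l ^ 2 = 0 := by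
    simp only [hS₁, hS₂, hP, hΔ, cyclicSum, cyclicProd, Fin.sum_univ_three, Fin.prod_univ_three,
      Fin.isValue, Fin.reduceAdd]
    fin_cases l <;> simp only [Fin.isValue, Fin.zero_eta, Fin.mk_one, Fin.reduceFinMk] <;> ring
  have h1 : transportC κ x θ D 0 = D⁻¹ * (κ : ℂ)⁻¹ ^ 2 * S₁ := by
    simp [transportC, hS₁, mul_comm]
  have h2 : transportC κ x θ D 1 = D⁻¹ * (Complex.I * (κ : ℂ)⁻¹) * S₂ := by
    simp only [transportC, hS₂, Matrix.cons_val, div_eq_mul_inv, mul_inv]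
    ring
  have h3 : transportC κ x θ D 2 = -(D⁻¹ * (κ : ℂ)⁻¹ ^ 2 * P) := by
    simp [transportC, hP, mul_comm]
  rw [← hΔ, div_eq_mul_inv] at hD
  rw [h1, h2, h3, div_eq_mul_inv]
  refine mul_left_cancel₀ hD0 ?_
  generalize (κ : ℂ)⁻¹ = K at *
  linear_combination (K ^ 2 * S₁ + Complex.I ^ 2 * K ^ 2 * S₂ * x l - K ^ 2 * P * θ (x l)) * hDD -
    Complex.I * K * x l ^ 2 * hD + (K ^ 2 * S₂ * x l - K ^ 2 * Δ * x l ^ 2) * Complex.I_sq +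
    K ^ 2 * key

theorem transportC_energy {κ : ℝ} (x : Fin 3 → ℂ) (θ : ℂ → ℂ) {D : ℂ} (hD0 : D ≠ 0)
    (hD : D = Complex.I / κ *
      (θ (x 0) * (x 2 - x 1) + θ (x 1) * (x 0 - x 2) + θ (x 2) * (x 1 - x 0))) (l : Fin 3) :
    transportC κ x θ D 3 + transportC κ x θ D 4 * (Complex.I * x l / κ) +
      transportC κ x θ D 5 * θ (x l) = θ (x l) * x l := by
  have hDD : D * D⁻¹ = 1 := mul_inv_cancel₀ hD0
  obtain ⟨Δ, hΔ⟩ : ∃ Δ, Δ = θ (x 0) * (x 2 - x 1) + θ (x 1) * (x 0 - x 2) +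
    θ (x 2) * (x 1 - x 0) := ⟨_, rfl⟩
  obtain ⟨S₁, hS₁⟩ : ∃ S, S = cyclicSum x fun a b c => b * (a - c) * θ a * θ c := ⟨_, rfl⟩
  obtain ⟨S₂, hS₂⟩ : ∃ S, S = cyclicSum x fun a _ c => (c - a) * θ a * θ c := ⟨_, rfl⟩
  obtain ⟨S₃, hS₃⟩ : ∃ S, S = cyclicSum x fun a b c => a * θ a * (b - c) := ⟨_, rfl⟩
  -- The same repeated-row determinant, now with rows `(1, x, θ, xθ)`.
  have key : S₁ + S₂ * x l - S₃ * θ (x l) - Δ * θ (x l) * x l = 0 := by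
    simp only [hS₁, hS₂, hS₃, hΔ, cyclicSum, Fin.sum_univ_three, Fin.isValue, Fin.reduceAdd]
    fin_cases l <;> simp only [Fin.isValue, Fin.zero_eta, Fin.mk_one, Fin.reduceFinMk] <;> ring
  have h1 : transportC κ x θ D 3 = D⁻¹ * (Complex.I * (κ : ℂ)⁻¹) * S₁ := by
    simp only [transportC, hS₁, Matrix.cons_val, div_eq_mul_inv, mul_inv]
    ring
  have h2 : transportC κ x θ D 4 = D⁻¹ * S₂ := by
    simp [transportC, hS₂]
  have h3 : transportC κ x θ D 5 = -(D⁻¹ * (Complex.I * (κ : ℂ)⁻¹) * S₃) := by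
    simp only [transportC, hS₃, Matrix.cons_val, div_eq_mul_inv, mul_inv]
    ring
  rw [← hΔ, div_eq_mul_inv] at hD
  rw [h1, h2, h3, div_eq_mul_inv]
  refine mul_left_cancel₀ hD0 ?_
  generalize (κ : ℂ)⁻¹ = K at *
  linear_combination Complex.I * K * (S₁ + S₂ * x l - S₃ * θ (x l)) * hDD -
    θ (x l) * x l * hD + Complex.I * K * key

theorem alignedMatrix_mul_diagonal {κ : ℝ} (hκ : κ ≠ 0) (ldiff lac lsh : ℂ) (θ : ℂ → ℂ) {D : ℂ}
    (hD0 : D ≠ 0) (hD : D = (alignedMatrix κ (simpleModes ldiff lac)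
      fun l => θ (simpleModes ldiff lac l)).det) :
    alignedMatrix κ (simpleModes ldiff lac) (fun l => θ (simpleModes ldiff lac l)) *
        Matrix.diagonal (allModes ldiff lac lsh) =
      hydroMatrix κ lsh (transportC κ (simpleModes ldiff lac) θ D) *
        alignedMatrix κ (simpleModes ldiff lac) fun l => θ (simpleModes ldiff lac l) := by
  rw [det_alignedMatrix] at hD
  have hm := transportC_momentum (simpleModes ldiff lac) θ hD0 hD
  have he := transportC_energy (simpleModes ldiff lac) θ hD0 hD
  have hκ' : (κ : ℂ) ≠ 0 := by exact_mod_cast hκ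
  -- The density row of the intertwining relation, i.e. the mass balance.
  have hrow : ∀ z : ℂ, z = -(Complex.I * κ * (Complex.I * z / κ)) := fun z => by
    field_simp
    linear_combination z * Complex.I_sq
  have a0 : allModes ldiff lac lsh 0 = simpleModes ldiff lac 0 := rfl
  have a1 : allModes ldiff lac lsh 1 = simpleModes ldiff lac 1 := rfl
  have a2 : allModes ldiff lac lsh 2 = simpleModes ldiff lac 2 := rfl
  have a3 : allModes ldiff lac lsh 3 = lsh := rfl
  have a4 : allModes ldiff lac lsh 4 = lsh := rfl
  generalize allModes ldiff lac lsh = y at a0 a1 a2 a3 a4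
  generalize transportC κ (simpleModes ldiff lac) θ D = C at hm he
  generalize simpleModes ldiff lac = x at *
  ext i j
  rw [Matrix.mul_diagonal, Matrix.mul_apply, Fin.sum_univ_five]
  fin_cases i <;> fin_cases j <;>
    simp [alignedMatrix, hydroMatrix, a0, a1, a2, a3, a4] <;>
    first | exact hrow _ | exact (hm _).symm | exact (he _).symm

/-- Conjugation fixes the diffusion mode and swaps the acoustic pair. The cyclic sums and the
product are alternating in the modes, hence purely imaginary; `D` carries an extra factor `i` and is
real. The explicit factors `i` then decide the type of each coefficient. -/
theorem exists_real_transportC (κ : ℝ) (ldiff lac : ℂ) (hdiff : ldiff.im = 0) (θ : ℂ → ℂ)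
    (hθ : ∀ z, θ (star z) = star (θ z)) {D : ℂ}
    (hD : D = (alignedMatrix κ (simpleModes ldiff lac)
      fun l => θ (simpleModes ldiff lac l)).det) :
    ∃ c : Fin 6 → ℝ, transportC κ (simpleModes ldiff lac) θ D =
      ![Complex.I * c 0, c 1, Complex.I * c 2, c 3, Complex.I * c 4, c 5] := by
  rw [det_alignedMatrix] at hD
  have h0 : (starRingEnd ℂ) ldiff = ldiff := Complex.conj_eq_iff_im.2 hdiff
  have ht : ∀ z, θ ((starRingEnd ℂ) z) = (starRingEnd ℂ) (θ z) := hθ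
  have ht0 : (starRingEnd ℂ) (θ ldiff) = θ ldiff := by rw [← ht, h0]
  have hDs : (starRingEnd ℂ) D = D := by
    rw [hD]
    simp [simpleModes, ht, h0, ht0]
    ring
  have him : ∀ z : ℂ, (starRingEnd ℂ) z = -z → z = Complex.I * (z.im : ℝ) := fun z hz => by
    have := congrArg Complex.re hz
    simp at this
    apply Complex.ext
    · simp; linarith
    · simp
  have hre : ∀ z : ℂ, (starRingEnd ℂ) z = z → z = (z.re : ℝ) := fun z hz =>
    (Complex.conj_eq_iff_re.1 hz).symm
  set C := transportC κ (simpleModes ldiff lac) θ D with hC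
  refine ⟨![(C 0).im, (C 1).re, (C 2).im, (C 3).re, (C 4).im, (C 5).re], ?_⟩
  ext i
  fin_cases i
  · refine him _ ?_
    simp [hC, transportC, cyclicSum, simpleModes, Fin.sum_univ_three, ht, hDs, h0, ht0]
    ring
  · refine hre _ ?_
    simp [hC, transportC, cyclicSum, simpleModes, Fin.sum_univ_three, ht, hDs, h0, ht0]
    ring
  · refine him _ ?_
    simp [hC, transportC, cyclicProd, simpleModes, Fin.prod_univ_three, hDs, h0]
    ring
  · refine hre _ ?_
    simp [hC, transportC, cyclicSum, simpleModes, Fin.sum_univ_three, ht, hDs, h0, ht0]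
    ring
  · refine him _ ?_
    simp [hC, transportC, cyclicSum, simpleModes, Fin.sum_univ_three, ht, hDs, h0, ht0]
    ring
  · refine hre _ ?_
    simp [hC, transportC, cyclicSum, simpleModes, Fin.sum_univ_three, ht, hDs, h0, ht0]
    ring

/-- The macroscopic variables of the normalized eigenvectors, in `k`-aligned coordinates. -/
def alignedColumn (τ κ : ℝ) (ldiff lac : ℂ) : Fin 5 → Fin 5 → ℂ :=
  ![simpleVector τ κ ldiff, simpleVector τ κ lac, simpleVector τ κ (star lac), Pi.single 2 1,
    Pi.single 3 1]

/-! ### Dynamics of the moments on the hydrodynamic manifold. -/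

theorem hasDerivWithinAt_moments {f : ℝ → Hv} {f' : Hv} {s : Set ℝ} {t : ℝ}
    (h : HasDerivWithinAt f f' s t) :
    HasDerivWithinAt (fun r => moments (f r)) (moments f') s t := by
  rw [hasDerivWithinAt_pi]
  intro j
  exact ((innerSL ℂ (e j)).restrictScalars ℝ).hasFDerivAt.comp_hasDerivWithinAt t h

/-- If every eigenvector to a mode has macroscopic variables that are an eigenvector of `N` to the
same eigenvalue, then `N` generates the dynamics on the hydrodynamic manifold. -/
theorem IsHydroSolution.hasDerivWithinAt_moments {τ : ℝ} {k : R3} {ldiff lac lsh : ℂ}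
    {N : Matrix (Fin 5) (Fin 5) ℂ}
    (hN : ∀ j, ∀ f ∈ eigenspace τ k (allModes ldiff lac lsh j),
      N.mulVec (moments f) = allModes ldiff lac lsh j • moments f)
    {f : ℝ → Hv} (hf : IsHydroSolution τ k ldiff lac lsh f) {t : ℝ} (ht : 0 ≤ t) :
    HasDerivWithinAt (fun s => moments (f s)) (N.mulVec (moments (f t))) (Set.Ici 0) t := by
  obtain ⟨hmem, f', hgraph, hderiv⟩ := hf t ht
  -- The graph is single-valued, so it suffices to exhibit some image of `f t` with the right
  -- moments; this property is additive and holds on each eigenspace.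
  have key : ∃ g, (f t, g) ∈ (bgkOp τ k).graph ∧ moments g = N.mulVec (moments (f t)) := by
    refine Submodule.iSup_induction _ (motive := fun f => ∃ g, (f, g) ∈ (bgkOp τ k).graph ∧
      moments g = N.mulVec (moments f)) hmem ?_ ?_ ?_
    · intro j u hu
      exact ⟨_, hu, by rw [moments_smul, hN j u hu]⟩
    · refine ⟨0, (bgkOp τ k).graph.zero_mem, ?_⟩
      have h0 : moments 0 = 0 := by simpa using moments_smul 0 0
      rw [h0, Matrix.mulVec_zero]
    · rintro u w ⟨g, hg, hgm⟩ ⟨g', hg', hgm'⟩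
      exact ⟨g + g', (bgkOp τ k).graph.add_mem hg hg', by
        rw [moments_add, moments_add, Matrix.mulVec_add, hgm, hgm']⟩
  obtain ⟨g, hg, hgm⟩ := key
  rw [← hgm, LinearPMap.mem_graph_snd_inj _ hg hgraph rfl]
  exact BGK.hasDerivWithinAt_moments hderiv

/-! ### The spectral basis and its matrix. -/

section modes

variable {τ : ℝ} (hτ : 0 < τ) {k : R3} (hk : 0 < ‖k‖) {Q : Matrix (Fin 3) (Fin 3) ℝ}
  (hQ : IsAligning k Q) {ldiff lac lsh : ℂ} (hmodes : IsHydroModes τ k ldiff lac lsh)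
include hτ hk hQ hmodes

theorem eigenspace_simple {j : Fin 5} {lam : ℂ} (hj : allModes ldiff lac lsh j = lam)
    (h1 : Module.finrank ℂ (eigenspace τ k lam) = 1) :
    (∃ f ∈ eigenspace τ k lam, moments f 0 = 1) ∧ ∀ f ∈ eigenspace τ k lam,
      alignedMoments Q f = moments f 0 • simpleVector τ ‖k‖ lam := by
  obtain ⟨hl, hl0⟩ := hj ▸ hmodes.mem_strip j
  refine ⟨exists_normalized hτ hk hQ hl hl0 h1, fun f hf => ?_⟩
  rw [← alignedMoments_zero Q]
  exact eq_smul_simpleVector hτ hk hQ hl hl0 (plasmaZ_ne_of_simple hτ hk hQ hl h1) hf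

/-- On a simple eigenspace the density fixes all moments, so the normalizations amount to
prescribing the whole aligned moment vector. Uniqueness then follows from `eigenspace_ext`. -/
theorem isSpectralBasis_iff {F : Fin 5 → Hv} :
    IsSpectralBasis τ k Q ldiff lac lsh F ↔
      ∀ j, F j ∈ eigenspace τ k (allModes ldiff lac lsh j) ∧
        alignedMoments Q (F j) = alignedColumn τ ‖k‖ ldiff lac j := by
  have s0 := (eigenspace_simple hτ hk hQ hmodes (j := 0) rfl (hmodes.simple 0)).2
  have s1 := (eigenspace_simple hτ hk hQ hmodes (j := 1) rfl (hmodes.simple 1)).2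
  have s2 := (eigenspace_simple hτ hk hQ hmodes (j := 2) rfl (hmodes.simple 2)).2
  have e2 : (![0, 0, 1, 0, 0] : Fin 5 → ℂ) = Pi.single 2 1 := by
    ext i; fin_cases i <;> rfl
  have e3 : (![0, 0, 0, 1, 0] : Fin 5 → ℂ) = Pi.single 3 1 := by
    ext i; fin_cases i <;> rfl
  have hal : ∀ (f : Hv) (c : Fin 5 → ℂ), moments f = (Qtilde Q).mulVec c ↔
      alignedMoments Q f = c := fun f c => by
    constructor
    · intro h
      rw [alignedMoments, h, Matrix.mulVec_mulVec, transpose_mul_Qtilde hQ.mul_transpose,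
        Matrix.one_mulVec]
    · intro h
      rw [← h]
      exact moments_eq_mulVec hQ.mul_transpose f
  constructor
  · intro h j
    refine ⟨h.eigen j, ?_⟩
    fin_cases j
    · exact (s0 _ (h.eigen 0)).trans (by rw [h.norm_diff, one_smul]; rfl)
    · exact (s1 _ (h.eigen 1)).trans (by rw [h.norm_ac, one_smul]; rfl)
    · exact (s2 _ (h.eigen 2)).trans (by rw [h.norm_ac_star, one_smul]; rfl)
    · exact ((hal _ _).1 h.shear_one).trans e2
    · exact ((hal _ _).1 h.shear_two).trans e3
  · intro h
    have hz : ∀ j, moments (F j) 0 = alignedColumn τ ‖k‖ ldiff lac j 0 := fun j => by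
      rw [← (h j).2, alignedMoments_zero]
    exact ⟨fun j => (h j).1, hz 0, hz 1, hz 2, (hal _ _).2 ((h 3).2.trans e2.symm),
      (hal _ _).2 ((h 4).2.trans e3.symm)⟩

theorem existsUnique_isSpectralBasis : ∃! F, IsSpectralBasis τ k Q ldiff lac lsh F := by
  have hex : ∀ j, ∃ f ∈ eigenspace τ k (allModes ldiff lac lsh j),
      alignedMoments Q f = alignedColumn τ ‖k‖ ldiff lac j := by
    have hs : ∀ {j : Fin 5} {lam : ℂ}, allModes ldiff lac lsh j = lam →
        Module.finrank ℂ (eigenspace τ k lam) = 1 → ∃ f ∈ eigenspace τ k lam,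
          alignedMoments Q f = simpleVector τ ‖k‖ lam := fun hj h1 => by
      obtain ⟨⟨f, hf, hf0⟩, h⟩ := eigenspace_simple hτ hk hQ hmodes hj h1
      exact ⟨f, hf, by rw [h f hf, hf0, one_smul]⟩
    obtain ⟨hl, hl0⟩ := hmodes.mem_strip 3
    have hZ := plasmaZ_eq_of_shear hτ hk hQ hl hl0 hmodes.shear
    intro j
    fin_cases j
    · exact hs (j := 0) rfl (hmodes.simple 0)
    · exact hs (j := 1) rfl (hmodes.simple 1)
    · exact hs (j := 2) rfl (hmodes.simple 2)
    · exact exists_shear hτ hk hQ hl (Or.inl rfl) hZ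
    · exact exists_shear hτ hk hQ hl (Or.inr rfl) hZ
  choose F hF using hex
  refine ⟨F, (isSpectralBasis_iff hτ hk hQ hmodes).2 hF, fun G hG => ?_⟩
  have hG' := (isSpectralBasis_iff hτ hk hQ hmodes).1 hG
  ext1 j
  exact eigenspace_ext hτ hk hQ (hmodes.mem_strip j).1 (hG' j).1 (hF j).1
    ((hG' j).2.trans (hF j).2.symm)

theorem spectralMatrix_eq {F : Fin 5 → Hv} (hF : IsSpectralBasis τ k Q ldiff lac lsh F) :
    spectralMatrix F = Qtilde Q * alignedMatrix ‖k‖ (simpleModes ldiff lac)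
      fun l => spectralTemp τ ‖k‖ (simpleModes ldiff lac l) := by
  have hcol : ∀ j l, alignedMatrix ‖k‖ (simpleModes ldiff lac)
      (fun l => spectralTemp τ ‖k‖ (simpleModes ldiff lac l)) l j =
        alignedColumn τ ‖k‖ ldiff lac j l := fun j l => by
    fin_cases j <;> fin_cases l <;> rfl
  ext i j
  rw [spectralMatrix, Matrix.of_apply, moments_eq_mulVec hQ.mul_transpose,
    ((isSpectralBasis_iff hτ hk hQ hmodes).1 hF j).2, Matrix.mul_apply]
  simp only [hcol]
  rfl

/-- The macroscopic variables of every eigenvector are an eigenvector of `N`, if those of the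
spectral basis are. -/
theorem mulVec_moments_of_mem_eigenspace {F : Fin 5 → Hv}
    (hF : IsSpectralBasis τ k Q ldiff lac lsh F) {N : Matrix (Fin 5) (Fin 5) ℂ}
    (hN : ∀ j, N.mulVec (moments (F j)) = allModes ldiff lac lsh j • moments (F j))
    (j : Fin 5) {f : Hv} (hf : f ∈ eigenspace τ k (allModes ldiff lac lsh j)) :
    N.mulVec (moments f) = allModes ldiff lac lsh j • moments f := by
  have hF' := (isSpectralBasis_iff hτ hk hQ hmodes).1 hF
  have hsimple : ∀ (i : Fin 5), alignedMoments Q f = moments f 0 • alignedColumn τ ‖k‖ ldiff lac i →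
      N.mulVec (moments f) = allModes ldiff lac lsh i • moments f := fun i h => by
    have : moments f = moments f 0 • moments (F i) := by
      conv_lhs => rw [moments_eq_mulVec hQ.mul_transpose f, h, ← (hF' i).2, Matrix.mulVec_smul,
        ← moments_eq_mulVec hQ.mul_transpose]
    rw [this, Matrix.mulVec_smul, hN, smul_comm]
  obtain ⟨hl, hl0⟩ := hmodes.mem_strip 3
  have hshear : f ∈ eigenspace τ k lsh → N.mulVec (moments f) = lsh • moments f := fun hf => by
    have h := alignedMoments_of_shear hτ hk hQ hl hl0 hmodes.shear hf
    have h3 : alignedMoments Q (F 3) = Pi.single 2 1 := (hF' 3).2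
    have h4 : alignedMoments Q (F 4) = Pi.single 3 1 := (hF' 4).2
    rw [← h3, ← h4] at h
    have hm : moments f = alignedMoments Q f 2 • moments (F 3) +
        alignedMoments Q f 3 • moments (F 4) := by
      conv_lhs => rw [moments_eq_mulVec hQ.mul_transpose f, h, Matrix.mulVec_add,
        Matrix.mulVec_smul, Matrix.mulVec_smul, ← moments_eq_mulVec hQ.mul_transpose,
        ← moments_eq_mulVec hQ.mul_transpose]
    have hN3 : N.mulVec (moments (F 3)) = lsh • moments (F 3) := hN 3
    have hN4 : N.mulVec (moments (F 4)) = lsh • moments (F 4) := hN 4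
    rw [hm, Matrix.mulVec_add, Matrix.mulVec_smul, Matrix.mulVec_smul, hN3, hN4, smul_add,
      smul_comm lsh, smul_comm lsh]
  fin_cases j
  · exact hsimple 0 ((eigenspace_simple hτ hk hQ hmodes (j := 0) rfl (hmodes.simple 0)).2 f hf)
  · exact hsimple 1 ((eigenspace_simple hτ hk hQ hmodes (j := 1) rfl (hmodes.simple 1)).2 f hf)
  · exact hsimple 2 ((eigenspace_simple hτ hk hQ hmodes (j := 2) rfl (hmodes.simple 2)).2 f hf)
  · exact hshear hf
  · exact hshear hf

end modes

end BGK

end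

theorem mainTheorem1 (τ : ℝ) (hτ : 0 < τ) (k : BGK.R3) (hk_pos : 0 < ‖k‖)
    (hk_crit : ‖k‖ < BGK.kCritMin τ) (Q : Matrix (Fin 3) (Fin 3) ℝ) (hQ : BGK.IsAligning k Q)
    (ldiff lac lsh : ℂ) (hmodes : BGK.IsHydroModes τ k ldiff lac lsh) :
    (∃! F : Fin 5 → BGK.Hv, BGK.IsSpectralBasis τ k Q ldiff lac lsh F) ∧
    ∀ F : Fin 5 → BGK.Hv, BGK.IsSpectralBasis τ k Q ldiff lac lsh F →
      ∀ H : Matrix (Fin 5) (Fin 5) ℂ, H = BGK.spectralMatrix F → IsUnit H.det →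
      ∀ C : Fin 6 → ℂ,
        C = BGK.transportC ‖k‖ (BGK.simpleModes ldiff lac) (BGK.spectralTemp τ ‖k‖) H.det →
      -- closed dynamics of the macroscopic variables on the hydrodynamic manifold
      (∀ f : ℝ → BGK.Hv, BGK.IsHydroSolution τ k ldiff lac lsh f → ∀ t : ℝ, 0 ≤ t →
        HasDerivWithinAt (fun s => BGK.moments (f s))
          ((H * Matrix.diagonal (BGK.allModes ldiff lac lsh) * H⁻¹).mulVec (BGK.moments (f t)))
          (Set.Ici 0) t) ∧
      -- explicit form of the generator
      H * Matrix.diagonal (BGK.allModes ldiff lac lsh) * H⁻¹ =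
        BGK.Qtilde Q * BGK.hydroMatrix ‖k‖ lsh C * (BGK.Qtilde Q).transpose ∧
      -- the transport coefficients are alternately purely imaginary and purely real
      ∃ c : Fin 6 → ℝ,
        C = ![Complex.I * c 0, c 1, Complex.I * c 2, c 3, Complex.I * c 4, c 5] ∧
        ∀ f : ℝ → BGK.Hv, BGK.IsHydroSolution τ k ldiff lac lsh f → ∀ t : ℝ, 0 ≤ t →
          HasDerivWithinAt (fun s => BGK.moments (f s))
            ((BGK.Qtilde Q * BGK.hydroMatrix ‖k‖ lsh
                ![Complex.I * c 0, c 1, Complex.I * c 2, c 3, Complex.I * c 4, c 5] *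
              (BGK.Qtilde Q).transpose).mulVec (BGK.moments (f t)))
            (Set.Ici 0) t := by
  refine ⟨BGK.existsUnique_isSpectralBasis hτ hk_pos hQ hmodes, ?_⟩
  rintro F hF H rfl hdet C rfl
  have hH := BGK.spectralMatrix_eq hτ hk_pos hQ hmodes hF
  set κ := ‖k‖
  set x := BGK.simpleModes ldiff lac with hx
  set θ := BGK.spectralTemp τ κ
  set H := BGK.spectralMatrix F with hHdef
  -- The rotation has determinant one, so the coefficients can be computed with the aligned matrix.
  have hD : H.det = (BGK.alignedMatrix κ x fun l => θ (x l)).det := by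
    rw [hH, Matrix.det_mul, BGK.det_Qtilde hQ.det_eq_one, one_mul]
  have hgen : H * Matrix.diagonal (BGK.allModes ldiff lac lsh) * H⁻¹ =
      BGK.Qtilde Q * BGK.hydroMatrix κ lsh (BGK.transportC κ x θ H.det) *
        (BGK.Qtilde Q).transpose := by
    have h1 : H * Matrix.diagonal (BGK.allModes ldiff lac lsh) =
        BGK.Qtilde Q * BGK.hydroMatrix κ lsh (BGK.transportC κ x θ H.det) *
          (BGK.Qtilde Q).transpose * H := by
      have h2 := BGK.alignedMatrix_mul_diagonal hk_pos.ne' ldiff lac lsh θ hdet.ne_zero hD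
      rw [← hx] at h2
      conv_lhs => rw [hH, Matrix.mul_assoc, h2]
      conv_rhs => rw [hH]
      rw [hH]
      simp only [Matrix.mul_assoc]
      rw [← Matrix.mul_assoc (BGK.Qtilde Q).transpose,
        BGK.transpose_mul_Qtilde hQ.mul_transpose, Matrix.one_mul]
    rw [h1, Matrix.mul_nonsing_inv_cancel_right _ _ hdet]
  have hdyn : ∀ f : ℝ → BGK.Hv, BGK.IsHydroSolution τ k ldiff lac lsh f → ∀ t : ℝ, 0 ≤ t →
      HasDerivWithinAt (fun s => BGK.moments (f s))
        ((H * Matrix.diagonal (BGK.allModes ldiff lac lsh) * H⁻¹).mulVec (BGK.moments (f t)))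
        (Set.Ici 0) t := by
    intro f hf t ht
    refine hf.hasDerivWithinAt_moments (fun j g hg => ?_) ht
    refine BGK.mulVec_moments_of_mem_eigenspace hτ hk_pos hQ hmodes hF (fun j => ?_) j hg
    -- The moments of the `j`-th basis vector are the `j`-th column of `H`, on which `H Λ H⁻¹` acts
    -- as the `j`-th eigenvalue.
    have hcol : BGK.moments (F j) = H.mulVec (Pi.single j 1) := by
      rw [Matrix.mulVec_single_one]
      rfl
    rw [hcol, Matrix.mulVec_mulVec, Matrix.nonsing_inv_mul_cancel_right _ _ hdet,
      ← Matrix.mulVec_mulVec, Matrix.diagonal_mulVec_single, mul_one, ← Matrix.mulVec_smul]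
    congr 1
    rw [← Pi.single_smul', smul_eq_mul, mul_one]
  obtain ⟨c, hc⟩ := BGK.exists_real_transportC κ ldiff lac hmodes.diff_real θ
    (BGK.spectralTemp_star τ κ) hD
  refine ⟨hdyn, hgen, c, hc, fun f hf t ht => ?_⟩
  rw [← hc, ← hx, ← hgen]
  exact hdyn f hf t ht
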